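/- Let $\Gamma$ be a compact metric graph, not necessarily connected: finitely many vertices and finitely many edges $e\cong[0,L_e]$ with $0<L_e<\infty$; loops and multiple edges are allowed. Let $V$ be a real potential in $L^2(\Gamma)=\bigoplus_e L^2(0,L_e)$. For a vertex $v$, let $\mathcal E_v$ be the set of edge ends attached to $v$ (a loop at $v$ contributes both of its ends), $d_v=|\mathcal E_v|$, and for $f\in\bigoplus_e H^2(0,L_e)$ let $F(v),F'(v)\in\mathbb C^{\mathcal E_v}$ be the vectors of the values of $f$ and of the derivatives of $f$ at $v$ along the edge ends in $\mathcal E_v$, derivatives being taken from the vertex into the edge. The Hamiltonian $\mathcal H$ of $\Gamma$ acts in $L^2(\Gamma)$ as $f\mapsto -f''+Vf$ on each edge, on the domain of all complex-valued $f\in\bigoplus_e H^2(0,L_e)$ that satisfy a given condition at each vertex. A condition at $v$ is called self-adjoint if it has the form $A_vF(v)+B_vF'(v)=0$ with $d_v\times d_v$ complex matrices such that $(A_v\,B_v)$ has rank $d_v$ and $A_vB_v^*$ is self-adjoint. The $\delta$-type condition with constant $\alpha\in\mathbb R$ at $v$ is: $f$ is continuous at $v$ (all entries of $F(v)$ are equal,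 to $f(v)$) and $\sum_{b\in\mathcal E_v}F'(v)_b=\alpha f(v)$. Let $v_0\neq v_1$ be vertices of $\Gamma$, each with at least one edge attached, endowed with the $\delta$-type conditions with constants $\alpha_0,\alpha_1\in\mathbb R$, and let arbitrary self-adjoint conditions be given at all other vertices. Let $\Gamma'$ be the graph obtained from $\Gamma$ by gluing $v_0$ and $v_1$ together into a single vertex $v$, so that $\mathcal E_v=\mathcal E_{v_0}\cup\mathcal E_{v_1}$, endowed with the $\delta$-type condition with constant $\alpha_0+\alpha_1$; the edges, their lengths, the potential and the conditions at the other vertices are unchanged. Then the eigenvalues of the Hamiltonian of $\Gamma$, and likewise those of the Hamiltonian of $\Gamma'$, are all real and can be listed in non-decreasing order, each repeated according to its (finite) multiplicity, as infinite sequences $\lambda_1(\Gamma)\le\lambda_2(\Gamma)\le\dots$ and $\lambda_1(\Gamma')\le\lambda_2(\Gamma')\le\dots$, and for all $n\ge 1$ \[ \lambda_n(\Gamma)\;\le\;\lambda_n(\Gamma')\;\le\;\lambda_{n+1}(\Gamma). \] -/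

import Mathlib

open MeasureTheory

noncomputable section

/-- A (linear, local) vertex condition at a vertex whose set of incident edge ends is `ι`: the
subspace of admissible pairs `(F, F')`, where `F` collects the values of a function at the vertex
along the incident edge ends and `F'` the derivatives taken from the vertex into the edges. -/
abbrev VertexCondition (ι : Type*) := Submodule ℂ ((ι → ℂ) × (ι → ℂ))

namespace VertexCondition

/-- A vertex condition is self-adjoint if it has the form `A F + B F' = 0` with square matrices
`A`, `B` such that the `d × 2d` matrix `(A B)` has maximal rank and `A B*` is self-adjoint. -/
def IsSelfAdjoint {ι : Type*} [Fintype ι] (M : VertexCondition ι) : Prop :=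
  ∃ A B : Matrix ι ι ℂ,
    (Matrix.fromCols A B).rank = Fintype.card ι ∧
    (A * B.conjTranspose).IsHermitian ∧
    ∀ F F' : ι → ℂ, (F, F') ∈ M ↔ A.mulVec F + B.mulVec F' = 0

/-- The δ-type condition with constant `α`: the function is continuous at the vertex, and the sum
of the derivatives into the edges equals `α` times the value at the vertex. -/
def delta (ι : Type*) [Fintype ι] (α : ℝ) : VertexCondition ι where
  carrier := {p | (∀ b c, p.1 b = p.1 c) ∧ ∀ b, ∑ c, p.2 c = (α : ℂ) * p.1 b}
  zero_mem' := by simp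
  add_mem' := by
    rintro p q ⟨hp, hp'⟩ ⟨hq, hq'⟩
    refine ⟨fun b c => ?_, fun b => ?_⟩
    · simp only [Prod.fst_add, Pi.add_apply, hp b c, hq b c]
    · simp only [Prod.fst_add, Prod.snd_add, Pi.add_apply, Finset.sum_add_distrib, hp' b, hq' b]
      ring
  smul_mem' := by
    rintro z p ⟨hp, hp'⟩
    refine ⟨fun b c => ?_, fun b => ?_⟩
    · simp only [Prod.smul_fst, Pi.smul_apply, hp b c]
    · simp only [Prod.smul_fst, Prod.smul_snd, Pi.smul_apply, smul_eq_mul, ← Finset.mul_sum, hp' b]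
      ring

/-- Transport of a vertex condition along a map of index sets: `(F, F')` is admissible
if its restriction along `i` is. -/
def transport {ι κ : Type*} (i : ι → κ) (M : VertexCondition ι) : VertexCondition κ :=
  M.comap ((LinearMap.funLeft ℂ ℂ i).prodMap (LinearMap.funLeft ℂ ℂ i))

end VertexCondition

/-- `u` belongs to the Sobolev space `H²(0, L)`, with first derivative `u'` and second derivative
`u''`: on `[0, L]`, `u` is a primitive of `u'`, and `u'` is a primitive of the `L²` function `u''`.
In particular `u` and `u'` are the continuous representatives, so that their values at the
endpoints of `[0, L]` are the Sobolev traces. -/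
structure IsSobolevH2 (L : ℝ) (u u' u'' : ℝ → ℂ) : Prop where
  memLp : MemLp u'' 2 (volume.restrict (Set.Icc 0 L))
  deriv_eq : ∀ x ∈ Set.Icc 0 L, u' x = u' 0 + ∫ t in (0 : ℝ)..x, u'' t
  eq : ∀ x ∈ Set.Icc 0 L, u x = u 0 + ∫ t in (0 : ℝ)..x, u' t

namespace IsSobolevH2

variable {L : ℝ} {u u' u'' w w' w'' : ℝ → ℂ}

theorem intervalIntegrable_snd (h : IsSobolevH2 L u u' u'') {x : ℝ} (hx : x ∈ Set.Icc 0 L) :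
    IntervalIntegrable u'' volume 0 x := by
  have h1 : IntegrableOn u'' (Set.Icc 0 L) volume := h.memLp.integrable (by norm_num)
  rw [intervalIntegrable_iff_integrableOn_Icc_of_le hx.1]
  exact h1.mono_set (Set.Icc_subset_Icc_right hx.2)

theorem continuousOn_fst (h : IsSobolevH2 L u u' u'') : ContinuousOn u' (Set.Icc 0 L) := by
  have h1 : IntegrableOn u'' (Set.Icc 0 L) volume := h.memLp.integrable (by norm_num)
  have h2 := intervalIntegral.continuousOn_primitive_Icc h1
  refine (continuousOn_const.add h2).congr (f := fun x => u' 0 + ∫ t in Set.Icc 0 x, u'' t) ?_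
  intro x hx
  show u' x = u' 0 + ∫ t in Set.Icc 0 x, u'' t
  rw [h.deriv_eq x hx, intervalIntegral.integral_of_le hx.1, integral_Icc_eq_integral_Ioc]

theorem intervalIntegrable_fst (h : IsSobolevH2 L u u' u'') {x : ℝ} (hx : x ∈ Set.Icc 0 L) :
    IntervalIntegrable u' volume 0 x := by
  refine ContinuousOn.intervalIntegrable ?_
  rw [Set.uIcc_of_le hx.1]
  exact h.continuousOn_fst.mono (Set.Icc_subset_Icc_right hx.2)

theorem zero (L : ℝ) : IsSobolevH2 L 0 0 0 :=
  ⟨MemLp.zero, by simp, by simp⟩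

theorem add (h : IsSobolevH2 L u u' u'') (k : IsSobolevH2 L w w' w'') :
    IsSobolevH2 L (u + w) (u' + w') (u'' + w'') where
  memLp := h.memLp.add k.memLp
  deriv_eq x hx := by
    simp only [Pi.add_apply]
    rw [intervalIntegral.integral_add (h.intervalIntegrable_snd hx) (k.intervalIntegrable_snd hx),
      h.deriv_eq x hx, k.deriv_eq x hx]
    ring
  eq x hx := by
    simp only [Pi.add_apply]
    rw [intervalIntegral.integral_add (h.intervalIntegrable_fst hx) (k.intervalIntegrable_fst hx),
      h.eq x hx, k.eq x hx]
    ring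

theorem smul (z : ℂ) (h : IsSobolevH2 L u u' u'') : IsSobolevH2 L (z • u) (z • u') (z • u'') where
  memLp := h.memLp.const_smul z
  deriv_eq x hx := by
    simp only [Pi.smul_apply, smul_eq_mul]
    rw [intervalIntegral.integral_const_mul, h.deriv_eq x hx]
    ring
  eq x hx := by
    simp only [Pi.smul_apply, smul_eq_mul]
    rw [intervalIntegral.integral_const_mul, h.eq x hx]
    ring

end IsSobolevH2

/-- A compact metric graph with vertex set `V` and edge set `E` (loops, multiple edges and several
components allowed), a real potential in `L²` on its edges, and a condition at every vertex.
The edge `e` is the segment `[0, length e]`; its ends are `(e, false)` (at `x = 0`) and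
`(e, true)` (at `x = length e`), and `vert` gives the vertex at which an edge end is attached. -/
structure QuantumGraph (V E : Type*) where
  vert : E × Bool → V
  length : E → ℝ
  length_pos : ∀ e, 0 < length e
  potential : E → ℝ → ℝ
  potential_memLp : ∀ e, MemLp (potential e) 2 (volume.restrict (Set.Icc 0 (length e)))
  cond : ∀ v, VertexCondition {b : E × Bool // vert b = v}

namespace QuantumGraph

variable {V E : Type*}

/-- The edge ends incident to the vertex `v` (a loop at `v` contributes both of its ends). -/
abbrev EndsAt (Γ : QuantumGraph V E) (v : V) : Type _ := {b : E × Bool // Γ.vert b = v}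

/-- The Lebesgue measure on the edge `e`. -/
abbrev edgeMeasure (Γ : QuantumGraph V E) (e : E) : Measure ℝ :=
  volume.restrict (Set.Icc 0 (Γ.length e))

/-- The Hilbert space `L²(Γ)`, the orthogonal direct sum of the spaces `L²(e)`. -/
abbrev L2 (Γ : QuantumGraph V E) : Type _ := PiLp 2 (fun e : E => Lp ℂ 2 (Γ.edgeMeasure e))

/-- The value of `u` at an edge end. -/
def endValue (Γ : QuantumGraph V E) (u : E → ℝ → ℂ) (b : E × Bool) : ℂ :=
  if b.2 then u b.1 (Γ.length b.1) else u b.1 0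

/-- The derivative at an edge end, taken into the edge; `u'` is the derivative with respect
to the coordinate `x` of the edge. -/
def endDeriv (Γ : QuantumGraph V E) (u' : E → ℝ → ℂ) (b : E × Bool) : ℂ :=
  if b.2 then -u' b.1 (Γ.length b.1) else u' b.1 0

/-- The Hamiltonian `f ↦ -f'' + V f` of the quantum graph, as the graph of an unbounded operator
in `L²(Γ)`: the set of pairs `(f, g)` such that `f` is in `H²` on every edge, satisfies all the
vertex conditions, and `g = -f'' + V f`. -/
def hamiltonian [Fintype E] (Γ : QuantumGraph V E) : Submodule ℂ (Γ.L2 × Γ.L2) where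
  carrier := {p | ∃ u u' u'' : E → ℝ → ℂ,
    (∀ e, IsSobolevH2 (Γ.length e) (u e) (u' e) (u'' e)) ∧
    (∀ e, p.1 e =ᵐ[Γ.edgeMeasure e] u e) ∧
    (∀ e, p.2 e =ᵐ[Γ.edgeMeasure e] fun x => -u'' e x + (Γ.potential e x : ℂ) * u e x) ∧
    ∀ v, ((fun b : Γ.EndsAt v => Γ.endValue u b), fun b : Γ.EndsAt v => Γ.endDeriv u' b)
      ∈ Γ.cond v}
  zero_mem' := by
    refine ⟨0, 0, 0, fun e => IsSobolevH2.zero _, fun e => ?_, fun e => ?_, fun v => ?_⟩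
    · exact Lp.coeFn_zero ℂ 2 (Γ.edgeMeasure e)
    · filter_upwards [Lp.coeFn_zero ℂ 2 (Γ.edgeMeasure e)] with x hx
      simpa using hx
    · convert (Γ.cond v).zero_mem using 1
      ext b <;> simp [endValue, endDeriv]
  add_mem' := by
    rintro p q ⟨u, u', u'', h1, h2, h3, h4⟩ ⟨w, w', w'', k1, k2, k3, k4⟩
    refine ⟨u + w, u' + w', u'' + w'', fun e => (h1 e).add (k1 e), fun e => ?_, fun e => ?_,
      fun v => ?_⟩
    · filter_upwards [Lp.coeFn_add (p.1 e) (q.1 e), h2 e, k2 e] with x hx hp hq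
      simp only [Prod.fst_add, PiLp.add_apply, Pi.add_apply] at hx ⊢
      rw [hx, hp, hq]
    · filter_upwards [Lp.coeFn_add (p.2 e) (q.2 e), h3 e, k3 e] with x hx hp hq
      simp only [Prod.snd_add, PiLp.add_apply, Pi.add_apply] at hx ⊢
      rw [hx, hp, hq]
      ring
    · convert (Γ.cond v).add_mem (h4 v) (k4 v) using 1
      refine Prod.ext (funext fun b => ?_) (funext fun b => ?_)
      · simp only [endValue, Prod.fst_add, Pi.add_apply]
        split_ifs <;> rfl
      · simp only [endDeriv, Prod.snd_add, Pi.add_apply]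
        split_ifs <;> ring
  smul_mem' := by
    rintro z p ⟨u, u', u'', h1, h2, h3, h4⟩
    refine ⟨z • u, z • u', z • u'', fun e => (h1 e).smul z, fun e => ?_, fun e => ?_,
      fun v => ?_⟩
    · filter_upwards [Lp.coeFn_smul z (p.1 e), h2 e] with x hx hp
      simp only [Prod.smul_fst, PiLp.smul_apply, Pi.smul_apply] at hx ⊢
      rw [hx, hp]
    · filter_upwards [Lp.coeFn_smul z (p.2 e), h3 e] with x hx hp
      simp only [Prod.smul_snd, PiLp.smul_apply, Pi.smul_apply, smul_eq_mul] at hx ⊢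
      rw [hx, hp]
      ring
    · convert (Γ.cond v).smul_mem z (h4 v) using 1
      refine Prod.ext (funext fun b => ?_) (funext fun b => ?_)
      · simp only [endValue, Prod.smul_fst, Pi.smul_apply]
        split_ifs <;> rfl
      · simp only [endDeriv, Prod.smul_snd, Pi.smul_apply, smul_eq_mul]
        split_ifs <;> ring

/-- The space of all `f` in the domain of the Hamiltonian with `H f = μ f`. -/
def eigenspace [Fintype E] (Γ : QuantumGraph V E) (μ : ℂ) : Submodule ℂ Γ.L2 :=
  Γ.hamiltonian.comap (LinearMap.id.prod (μ • LinearMap.id))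

/-- `l 0 ≤ l 1 ≤ l 2 ≤ …` is the list of all eigenvalues of the Hamiltonian in non-decreasing
order, each eigenvalue being repeated according to its multiplicity. -/
def IsEigenvalueSequence [Fintype E] (Γ : QuantumGraph V E) (l : ℕ → ℝ) : Prop :=
  Monotone l ∧
    ∀ μ : ℂ, {n : ℕ | (l n : ℂ) = μ}.encard = Cardinal.toENat (Module.rank ℂ (Γ.eigenspace μ))

/-- The map of vertex sets that glues `v₁` to `v₀`; the vertex set after gluing is
`V \ {v₁}`, and its element `v₀` is the glued vertex. -/
def glueMap [DecidableEq V] (v₀ v₁ : V) (h : v₀ ≠ v₁) (v : V) : {v : V // v ≠ v₁} :=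
  if hv : v = v₁ then ⟨v₀, h⟩ else ⟨v, hv⟩

theorem glueMap_coe [DecidableEq V] (v₀ v₁ : V) (h : v₀ ≠ v₁) (w : {v : V // v ≠ v₁}) :
    glueMap v₀ v₁ h w.1 = w := by
  simp [glueMap, w.2]

/-- The quantum graph obtained by gluing the vertices `v₀` and `v₁` into a single vertex endowed
with the δ-type condition with constant `α`. Edges, lengths and potential are unchanged, and so
are the conditions at all the other vertices (whose sets of incident edge ends do not change). -/
def glue [DecidableEq V] [Fintype E] (Γ : QuantumGraph V E) (v₀ v₁ : V) (h : v₀ ≠ v₁) (α : ℝ) :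
    QuantumGraph {v : V // v ≠ v₁} E where
  vert b := glueMap v₀ v₁ h (Γ.vert b)
  length := Γ.length
  length_pos := Γ.length_pos
  potential := Γ.potential
  potential_memLp := Γ.potential_memLp
  cond w :=
    if w.1 = v₀ then VertexCondition.delta _ α
    else VertexCondition.transport
      (fun b : Γ.EndsAt w.1 =>
        ⟨b.1, (congrArg (glueMap v₀ v₁ h) b.2).trans (glueMap_coe v₀ v₁ h w)⟩)
      (Γ.cond w.1)

end QuantumGraph

end

/-!
A large shift `H + c` of a Hamiltonian is positive and has a compact inverse: on a single edge a
function is determined by the data `(u'', u(0), u'(0))`, in terms of which `H + c` together with the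
vertex conditions is a compact perturbation of an isomorphism, so that the Fredholm alternative
applies. Hence the spectrum is an infinite sequence of eigenvalues of finite multiplicity, and
eigenvalues can be compared through the compact positive resolvents by the min-max principle.

Gluing `v₀` and `v₁` restricts the form domain by the one condition that the values at `v₀` and `v₁`
agree, and does not change the quadratic form. So the resolvent of `Γ'` is bounded above by that of
`Γ`, and both coincide on the kernel of a single linear functional. These two facts give the two
inequalities.
-/

/-! ### Linear relations with compact positive resolvent -/

section Enumeration

theorem exists_orderIso_nat {I : Type*} [LinearOrder I] [Infinite I]
    (h : ∀ i : I, (Set.Iio i).Finite) : Nonempty (ℕ ≃o I) := by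
  have hrank : StrictMono fun i : I => (Set.Iio i).ncard := fun i j hij =>
    Set.ncard_lt_ncard (Set.Iio_ssubset_Iio hij) (h j)
  have : Infinite (Set.range fun i : I => (Set.Iio i).ncard) :=
    Set.infinite_coe_iff.2 (Set.infinite_range_of_injective hrank.injective)
  exact ⟨(Nat.Subtype.orderIsoOfNat _).trans hrank.orderIso.symm⟩

theorem exists_equiv_nat_monotone {I α : Type*} [LinearOrder α] [Infinite I] (f : I → α)
    (hf : ∀ a, {i | f i ≤ a}.Finite) : ∃ σ : ℕ ≃ I, Monotone (f ∘ σ) := by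
  -- ties are broken by an arbitrary linear order on `I`
  classical
  let _ : LinearOrder I := linearOrderOfSTO WellOrderingRel
  let key : I → α ×ₗ I := fun i => toLex (f i, i)
  have hkey : Function.Injective key := fun i j h => congrArg (fun p => (ofLex p).2) h
  let e : I ≃ Set.range key := Equiv.ofInjective key hkey
  have hle : ∀ p q : Set.range key, p ≤ q → f (e.symm p) ≤ f (e.symm q) := by
    rintro p q hpq
    obtain ⟨i, rfl⟩ := e.surjective p
    obtain ⟨j, rfl⟩ := e.surjective q
    rw [e.symm_apply_apply, e.symm_apply_apply]
    exact Prod.Lex.monotone_fst (key i) (key j) hpq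
  have hfin : ∀ p : Set.range key, (Set.Iio p).Finite := fun p =>
    ((hf (f (e.symm p))).preimage e.symm.injective.injOn).subset fun q hq => hle q p (le_of_lt hq)
  have : Infinite (Set.range key) := e.infinite_iff.1 ‹_›
  obtain ⟨σ⟩ := exists_orderIso_nat hfin
  exact ⟨σ.toEquiv.trans e.symm, fun m n hmn => hle _ _ (σ.monotone hmn)⟩

end Enumeration

section Spectral

open scoped InnerProductSpace

section HilbertBasis

variable {𝕜 H I : Type*} [RCLike 𝕜] [NormedAddCommGroup H] [InnerProductSpace 𝕜 H]

theorem exists_hilbertBasis_forall_mem [CompleteSpace H] {J : Type*} {W : J → Submodule 𝕜 H}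
    [∀ j, FiniteDimensional 𝕜 (W j)]
    (hW : OrthogonalFamily 𝕜 (fun j => W j) fun j => (W j).subtypeₗᵢ) (hspan : (⨆ j, W j)ᗮ = ⊥)
    {f : I → J} (hf : ∀ j, {i | f i = j}.encard = Module.finrank 𝕜 (W j)) :
    ∃ b : HilbertBasis I 𝕜 H, ∀ i, b i ∈ W (f i) := by
  have hfibre : ∀ j, Nonempty (Fin (Module.finrank 𝕜 (W j)) ≃ {i // f i = j}) := fun j => by
    have hcard : ENat.card {i // f i = j} = Module.finrank 𝕜 (W j) := hf j
    have : Finite {i // f i = j} := ENat.card_lt_top.1 (hcard ▸ ENat.natCast_lt_top _)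
    rw [ENat.card_eq_coe_natCard, Nat.cast_inj] at hcard
    exact ⟨(Finite.equivFinOfCardEq hcard).symm⟩
  let e : (Σ j, Fin (Module.finrank 𝕜 (W j))) ≃ I :=
    (Equiv.sigmaCongrRight fun j => (hfibre j).some).trans (Equiv.sigmaFiberEquiv f)
  have he : ∀ i, (e.symm i).1 = f i := fun i => by
    conv_rhs => rw [← e.apply_symm_apply i]
    exact ((hfibre (e.symm i).1).some (e.symm i).2).2.symm
  let u : (Σ j, Fin (Module.finrank 𝕜 (W j))) → H := fun p => stdOrthonormalBasis 𝕜 (W p.1) p.2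
  have hu : Orthonormal 𝕜 u :=
    hW.orthonormal_sigma_orthonormal fun j => (stdOrthonormalBasis 𝕜 (W j)).orthonormal
  have hle : ∀ j, W j ≤ Submodule.span 𝕜 (Set.range (u ∘ e.symm)) := fun j => by
    rw [e.symm.surjective.range_comp, ← Submodule.map_subtype_top (W j),
      ← (stdOrthonormalBasis 𝕜 (W j)).toBasis.span_eq, Submodule.map_span]
    refine Submodule.span_mono ?_
    rintro _ ⟨_, ⟨k, rfl⟩, rfl⟩
    exact ⟨⟨j, k⟩, by simp [u]⟩
  refine ⟨HilbertBasis.mkOfOrthogonalEqBot (hu.comp _ e.symm.injective)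
    (eq_bot_iff.2 ((Submodule.orthogonal_le (iSup_le hle)).trans hspan.le)), fun i => ?_⟩
  rw [HilbertBasis.coe_mkOfOrthogonalEqBot, ← he i]
  exact (stdOrthonormalBasis 𝕜 (W (e.symm i).1) (e.symm i).2).2

variable (b : HilbertBasis I 𝕜 H) {T : H →ₗ[𝕜] H} {s : I → ℝ} {x : H} {t : ℝ}

theorem hasSum_mul_norm_inner_sq (hT : T.IsSymmetric) (hb : ∀ i, T (b i) = (s i : 𝕜) • b i)
    (x : H) : HasSum (fun i => s i * ‖⟪b i, x⟫_𝕜‖ ^ 2) (RCLike.re ⟪T x, x⟫_𝕜) := by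
  refine (RCLike.reCLM.hasSum (b.hasSum_inner_mul_inner (T x) x)).congr_fun fun i => ?_
  have hcoord : ⟪T x, b i⟫_𝕜 * ⟪b i, x⟫_𝕜 = ((s i * ‖⟪b i, x⟫_𝕜‖ ^ 2 : ℝ) : 𝕜) := by
    rw [hT, hb, inner_smul_right, ← inner_conj_symm x (b i), mul_assoc, RCLike.conj_mul]
    push_cast
    rfl
  simp only [hcoord, RCLike.reCLM_apply, RCLike.ofReal_re]

theorem hasSum_norm_inner_sq (x : H) : HasSum (fun i => ‖⟪b i, x⟫_𝕜‖ ^ 2) (‖x‖ ^ 2) := by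
  simpa only [Pi.one_apply, one_mul, LinearMap.id_apply, inner_self_eq_norm_sq] using
    hasSum_mul_norm_inner_sq b (T := LinearMap.id) (s := 1) LinearMap.IsSymmetric.id (by simp) x

theorem re_inner_le_of_forall_le (hT : T.IsSymmetric) (hb : ∀ i, T (b i) = (s i : 𝕜) • b i)
    (hx : ∀ i, ⟪b i, x⟫_𝕜 ≠ 0 → s i ≤ t) : RCLike.re ⟪T x, x⟫_𝕜 ≤ t * ‖x‖ ^ 2 := by
  refine hasSum_le (fun i => ?_) (hasSum_mul_norm_inner_sq b hT hb x)
    ((hasSum_norm_inner_sq b x).mul_left t)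
  by_cases h : ⟪b i, x⟫_𝕜 = 0
  · simp [h]
  · exact mul_le_mul_of_nonneg_right (hx i h) (by positivity)

theorem le_re_inner_of_forall_le (hT : T.IsSymmetric) (hb : ∀ i, T (b i) = (s i : 𝕜) • b i)
    (hx : ∀ i, ⟪b i, x⟫_𝕜 ≠ 0 → t ≤ s i) : t * ‖x‖ ^ 2 ≤ RCLike.re ⟪T x, x⟫_𝕜 := by
  refine hasSum_le (fun i => ?_) ((hasSum_norm_inner_sq b x).mul_left t)
    (hasSum_mul_norm_inner_sq b hT hb x)
  by_cases h : ⟪b i, x⟫_𝕜 = 0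
  · simp [h]
  · exact mul_le_mul_of_nonneg_right (hx i h) (by positivity)

theorem exists_ne_zero_inner_eq_zero_of_finrank_lt (b : HilbertBasis ℕ 𝕜 H) {W : Type*}
    [AddCommGroup W] [Module 𝕜 W] [FiniteDimensional 𝕜 W] (φ : H →ₗ[𝕜] W) {m : ℕ}
    (hm : Module.finrank 𝕜 W < m) :
    ∃ x : H, x ≠ 0 ∧ φ x = 0 ∧ ∀ i, ⟪b i, x⟫_𝕜 ≠ 0 → i < m := by
  let v : Fin m → H := fun i => b i
  have hv : LinearIndependent 𝕜 v := b.orthonormal.linearIndependent.comp _ Fin.val_injective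
  obtain ⟨a, ha, ha0⟩ := Submodule.exists_mem_ne_zero_of_ne_bot
    (LinearMap.ker_ne_bot_of_finrank_lt (f := φ ∘ₗ Fintype.linearCombination 𝕜 v)
      (by simpa using hm))
  refine ⟨Fintype.linearCombination 𝕜 v a, ?_, ha, fun i hi => ?_⟩
  · rwa [Ne, map_eq_zero_iff _ (linearIndependent_iff_injective_fintypeLinearCombination.1 hv)]
  · contrapose! hi
    rw [Fintype.linearCombination_apply, inner_sum]
    refine Finset.sum_eq_zero fun j _ => ?_
    rw [inner_smul_right, b.orthonormal.2 (j.2.trans_le hi).ne', mul_zero]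

theorem le_norm_smul_sub_smul {v : I → H} (hv : Orthonormal 𝕜 v) {i j : I} (hij : i ≠ j)
    (s t : 𝕜) : ‖s‖ ≤ ‖s • v i - t • v j‖ := by
  have hinner : ⟪v i, s • v i - t • v j⟫_𝕜 = s := by
    rw [inner_sub_right, inner_smul_right, inner_smul_right, hv.2 hij,
      inner_self_eq_one_of_norm_eq_one (hv.1 i), mul_one, mul_zero, sub_zero]
  simpa [hinner, hv.1 i] using norm_inner_le_norm (𝕜 := 𝕜) (v i) (s • v i - t • v j)

theorem finite_setOf_le_norm_eigenvalue {T : H →ₗ[𝕜] H} (hT : IsCompactOperator T) {v : I → H}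
    (hv : Orthonormal 𝕜 v) {s : I → 𝕜} (hs : ∀ i, T (v i) = s i • v i) (ht : 0 < t) :
    {i | t ≤ ‖s i‖}.Finite := by
  by_contra hinf
  obtain ⟨ν, hν⟩ := (Set.not_finite.1 hinf).natEmbedding
  obtain ⟨K, hK, hTK⟩ := hT.image_closedBall_subset_compact (σ₁₂ := RingHom.id 𝕜) 1
  obtain ⟨y, -, κ, hκ, hlim⟩ := hK.tendsto_subseq (x := fun n => T (v (ν n))) fun n =>
    hTK ⟨v (ν n), by simp [hv.1], rfl⟩
  obtain ⟨N, hN⟩ := Metric.cauchySeq_iff.1 hlim.cauchySeq t ht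
  have hne : (ν (κ N) : I) ≠ ν (κ (N + 1)) := fun h =>
    (hκ N.lt_succ_self).ne (hν (Subtype.ext h))
  have hsep := (ν (κ N)).2.trans (le_norm_smul_sub_smul hv hne (s _) (s (ν (κ (N + 1)))))
  refine (hN N le_rfl (N + 1) N.le_succ).not_ge ?_
  simpa only [Function.comp_apply, dist_eq_norm, hs] using hsep

end HilbertBasis

variable {H : Type*} [NormedAddCommGroup H] [InnerProductSpace ℂ H]

/-- A linear relation in `H`: the graph of an unbounded operator, stored as the subspace of the
pairs `(f, A f)`. -/
abbrev LinearRelation (H : Type*) [AddCommGroup H] [Module ℂ H] := Submodule ℂ (H × H)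

namespace LinearRelation

/-- The eigenspace of a linear relation: all `f` related to `μ f`. -/
def eigenspace (A : LinearRelation H) (μ : ℂ) : Submodule ℂ H :=
  A.comap (LinearMap.id.prod (μ • LinearMap.id))

/-- `l` is the list of all eigenvalues of `A` in non-decreasing order, with multiplicity. -/
def IsEigenvalueSequence (A : LinearRelation H) (l : ℕ → ℝ) : Prop :=
  Monotone l ∧
    ∀ μ : ℂ, {n : ℕ | (l n : ℂ) = μ}.encard = Cardinal.toENat (Module.rank ℂ (A.eigenspace μ))

/-- `R` is the inverse of `A + c`, and it is a compact positive operator. -/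
structure IsPositiveResolvent (A : LinearRelation H) (c : ℝ) (R : H →L[ℂ] H) : Prop where
  mem_iff : ∀ f g, (f, g) ∈ A ↔ R (g + (c : ℂ) • f) = f
  isCompact : IsCompactOperator R
  isPositive : R.IsPositive
  injective : Function.Injective R

namespace IsPositiveResolvent

variable {A A' : LinearRelation H} {c : ℝ} {R R' : H →L[ℂ] H}

theorem mem_eigenspace_iff (hR : A.IsPositiveResolvent c R) {μ : ℂ} {x : H} :
    x ∈ A.eigenspace μ ↔ (μ + c) • R x = x := by
  change (x, μ • x) ∈ A ↔ _
  rw [hR.mem_iff, ← add_smul, map_smul]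

theorem eigenspace_eq (hR : A.IsPositiveResolvent c R) (μ : ℂ) :
    A.eigenspace μ = Module.End.eigenspace (R : H →ₗ[ℂ] H) (μ + c)⁻¹ := by
  ext x
  rw [hR.mem_eigenspace_iff, Module.End.mem_eigenspace_iff, ContinuousLinearMap.coe_coe]
  by_cases h : μ + c = 0
  · rw [h, inv_zero, zero_smul, zero_smul, map_eq_zero_iff R hR.injective, eq_comm]
  · rw [eq_inv_smul_iff₀ h]

theorem finiteDimensional_eigenspace [CompleteSpace H] (hR : A.IsPositiveResolvent c R) (μ : ℂ) :
    FiniteDimensional ℂ (A.eigenspace μ) := by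
  by_cases h : μ + c = 0
  · have hbot : A.eigenspace μ = ⊥ := by
      rw [eq_bot_iff]
      intro x hx
      rw [hR.mem_eigenspace_iff, h, zero_smul] at hx
      exact hx.symm
    rw [hbot]
    infer_instance
  · rw [hR.eigenspace_eq]
    exact ContinuousLinearMap.finite_dimensional_eigenspace hR.isCompact _ (inv_ne_zero h)

open scoped ComplexOrder in
theorem add_pos_of_mem_eigenspace (hR : A.IsPositiveResolvent c R) {μ : ℂ} {x : H}
    (hx : x ∈ A.eigenspace μ) (hx0 : x ≠ 0) : 0 < μ + c := by
  rw [hR.mem_eigenspace_iff] at hx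
  have hne : μ + c ≠ 0 := by
    intro h
    exact hx0 (by rw [← hx, h, zero_smul])
  have hRx : 0 < ‖R x‖ ^ 2 := by
    have : R x ≠ 0 := fun h => hx0 (by rw [← hx, h, smul_zero])
    positivity
  have hinner : ⟪R x, x⟫_ℂ = (μ + c) * (‖R x‖ ^ 2 : ℝ) := by
    rw [← congrArg (inner ℂ (R x)) hx, inner_smul_right, inner_self_eq_norm_sq_to_K]
    norm_cast
  have hquot : μ + c = ⟪R x, x⟫_ℂ * ((‖R x‖ ^ 2)⁻¹ : ℝ) := by
    rw [hinner, mul_assoc, ← Complex.ofReal_mul, mul_inv_cancel₀ hRx.ne', Complex.ofReal_one,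
      mul_one]
  refine lt_of_le_of_ne ?_ hne.symm
  rw [hquot]
  exact mul_nonneg (hR.isPositive.inner_nonneg_left x)
    (Complex.zero_le_real.2 (inv_nonneg.2 hRx.le))

open scoped ComplexOrder in
theorem apply_hilbertBasis (hR : A.IsPositiveResolvent c R) {I : Type*} {f : I → ℂ}
    {b : HilbertBasis I ℂ H} (hb : ∀ i, b i ∈ A.eigenspace (f i)) (i : I) :
    (f i).im = 0 ∧ 0 < (f i).re + c ∧ R (b i) = ((((f i).re + c)⁻¹ : ℝ) : ℂ) • b i := by
  have hpos := hR.add_pos_of_mem_eigenspace (hb i) (b.orthonormal.ne_zero i)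
  have him : (f i).im = 0 := by simpa using (Complex.pos_iff.1 hpos).2.symm
  have hre : 0 < (f i).re + c := by simpa using (Complex.pos_iff.1 hpos).1
  have hcast : f i + c = ((f i).re + c : ℝ) := Complex.ext (by simp) (by simp [him])
  refine ⟨him, hre, ?_⟩
  have heig := hR.eigenspace_eq (f i) ▸ hb i
  rwa [hcast, ← Complex.ofReal_inv, Module.End.mem_eigenspace_iff] at heig

variable [CompleteSpace H]

theorem exists_hilbertBasis (hR : A.IsPositiveResolvent c R) {I : Type*} {f : I → ℂ}
    (hf : ∀ μ, {i | f i = μ}.encard = Cardinal.toENat (Module.rank ℂ (A.eigenspace μ))) :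
    ∃ b : HilbertBasis I ℂ H, ∀ i, b i ∈ A.eigenspace (f i) := by
  have hfin := hR.finiteDimensional_eigenspace
  have hbij : Function.Bijective fun μ : ℂ => (μ + c)⁻¹ :=
    inv_involutive.bijective.comp (Equiv.addRight (c : ℂ)).bijective
  have heig : A.eigenspace = fun μ : ℂ => Module.End.eigenspace (R : H →ₗ[ℂ] H) (μ + c)⁻¹ :=
    funext hR.eigenspace_eq
  refine exists_hilbertBasis_forall_mem ?_ ?_ fun μ => ?_
  · rw [heig]
    exact hR.isPositive.isSymmetric.orthogonalFamily_eigenspaces.comp hbij.injective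
  · rw [heig, hbij.surjective.iSup_comp (g := Module.End.eigenspace (R : H →ₗ[ℂ] H))]
    exact ContinuousLinearMap.orthogonalComplement_iSup_eigenspaces_eq_bot hR.isCompact
      hR.isPositive.isSymmetric
  · rw [hf, ← Module.finrank_eq_rank, Cardinal.toENat_nat]

theorem exists_isEigenvalueSequence (hR : A.IsPositiveResolvent c R)
    (hH : ¬ FiniteDimensional ℂ H) : ∃ l, A.IsEigenvalueSequence l := by
  have hfin := hR.finiteDimensional_eigenspace
  let I := Σ μ : ℂ, Fin (Module.finrank ℂ (A.eigenspace μ))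
  have hfibre : ∀ μ, {i : I | i.1 = μ}.encard =
      Cardinal.toENat (Module.rank ℂ (A.eigenspace μ)) := fun μ => by
    rw [← Module.finrank_eq_rank, Cardinal.toENat_nat]
    exact (ENat.card_congr (Equiv.sigmaSubtype μ)).trans (by simp)
  obtain ⟨b, hb⟩ := hR.exists_hilbertBasis hfibre
  have : Infinite I := by
    by_contra hI
    have := not_infinite_iff_finite.1 hI
    have := Fintype.ofFinite I
    exact hH b.toOrthonormalBasis.toBasis.finiteDimensional_of_finite
  have hsublevel : ∀ t : ℝ, {i : I | i.1.re ≤ t}.Finite := fun t => by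
    by_cases ht : 0 < t + c
    · refine (finite_setOf_le_norm_eigenvalue hR.isCompact b.orthonormal
        (fun i => (hR.apply_hilbertBasis hb i).2.2) (inv_pos.2 ht)).subset fun i hi => ?_
      have hpos := (hR.apply_hilbertBasis hb i).2.1
      rw [Set.mem_ofPred_eq, Complex.norm_real, Real.norm_of_nonneg (inv_nonneg.2 hpos.le)]
      exact inv_anti₀ hpos (add_le_add_left hi c)
    · refine Set.finite_empty.subset fun i hi => ht ?_
      exact (hR.apply_hilbertBasis hb i).2.1.trans_le (add_le_add_left hi c)
  obtain ⟨σ, hσ⟩ := exists_equiv_nat_monotone _ hsublevel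
  refine ⟨_, hσ, fun μ => ?_⟩
  have hlevel : {n | (((fun i : I => i.1.re) ∘ σ) n : ℂ) = μ} = σ ⁻¹' {i | i.1 = μ} := by
    ext n
    have hreal : ((σ n).1.re : ℂ) = (σ n).1 :=
      Complex.ext rfl (hR.apply_hilbertBasis hb (σ n)).1.symm
    simp [hreal]
  rw [hlevel, Set.encard_preimage_of_bijective σ.bijective, hfibre]

theorem exists_hilbertBasis_nat (hR : A.IsPositiveResolvent c R) {l : ℕ → ℝ}
    (hl : A.IsEigenvalueSequence l) :
    ∃ b : HilbertBasis ℕ ℂ H, ∀ n, 0 < l n + c ∧ R (b n) = (((l n + c)⁻¹ : ℝ) : ℂ) • b n := by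
  obtain ⟨b, hb⟩ := hR.exists_hilbertBasis hl.2
  exact ⟨b, fun n => by simpa only [Complex.ofReal_re] using (hR.apply_hilbertBasis hb n).2⟩

theorem eigenvalue_le_add_finrank (hR : A.IsPositiveResolvent c R)
    (hR' : A'.IsPositiveResolvent c R') {W : Type*} [AddCommGroup W] [Module ℂ W]
    [FiniteDimensional ℂ W] (φ : H →ₗ[ℂ] W)
    (hφ : ∀ x, φ x = 0 → (⟪R' x, x⟫_ℂ).re ≤ (⟪R x, x⟫_ℂ).re) {l l' : ℕ → ℝ}
    (hl : A.IsEigenvalueSequence l) (hl' : A'.IsEigenvalueSequence l') (n : ℕ) :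
    l n ≤ l' (n + Module.finrank ℂ W) := by
  obtain ⟨b, hb⟩ := hR.exists_hilbertBasis_nat hl
  obtain ⟨b', hb'⟩ := hR'.exists_hilbertBasis_nat hl'
  set N := n + Module.finrank ℂ W
  let coords : H →ₗ[ℂ] (Fin n → ℂ) := LinearMap.pi fun i => innerₛₗ ℂ (b i)
  obtain ⟨x, hx0, hx, hlow⟩ := exists_ne_zero_inner_eq_zero_of_finrank_lt b' (coords.prod φ)
    (m := N + 1) (by simp [N])
  obtain ⟨hcoords, hφx⟩ := Prod.mk_eq_zero.1 hx
  have hhigh : ∀ i, ⟪b i, x⟫_ℂ ≠ 0 → n ≤ i := fun i hi => by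
    by_contra! hin
    exact hi (congrFun hcoords ⟨i, hin⟩)
  have hnorm : 0 < ‖x‖ ^ 2 := by positivity
  have hinv : (l' N + c)⁻¹ * ‖x‖ ^ 2 ≤ (l n + c)⁻¹ * ‖x‖ ^ 2 := calc
    (l' N + c)⁻¹ * ‖x‖ ^ 2 ≤ (⟪R' x, x⟫_ℂ).re :=
      le_re_inner_of_forall_le b' hR'.isPositive.isSymmetric (fun i => (hb' i).2) fun i hi =>
        inv_anti₀ (hb' i).1 (add_le_add_left (hl'.1 (Nat.lt_succ_iff.1 (hlow i hi))) c)
    _ ≤ (⟪R x, x⟫_ℂ).re := hφ x hφx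
    _ ≤ (l n + c)⁻¹ * ‖x‖ ^ 2 :=
      re_inner_le_of_forall_le b hR.isPositive.isSymmetric (fun i => (hb i).2) fun i hi =>
        inv_anti₀ (hb n).1 (add_le_add_left (hl.1 (hhigh i hi)) c)
  have hle := (inv_le_inv₀ (hb' N).1 (hb n).1).1 (le_of_mul_le_mul_right hinv hnorm)
  linarith

end IsPositiveResolvent
end LinearRelation

end Spectral

/-! ### Calculus of Sobolev functions on an interval -/

section Interval

open Set intervalIntegral

open scoped ComplexConjugate

/-- `f` is, on `[0, L]`, a primitive of the integrable function `f'`; the functions with this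
property form the Sobolev space `W¹¹(0, L)`. -/
structure IsPrimitive {E : Type*} [NormedAddCommGroup E] [NormedSpace ℝ E] (L : ℝ)
    (f f' : ℝ → E) : Prop where
  integrableOn : IntegrableOn f' (Icc 0 L)
  eq_add_integral : ∀ x ∈ Icc 0 L, f x = f 0 + ∫ t in (0 : ℝ)..x, f' t

namespace IsPrimitive

variable {E : Type*} [NormedAddCommGroup E] [NormedSpace ℝ E] {L : ℝ} {f f' : ℝ → E}

theorem intervalIntegrable (h : IsPrimitive L f f') {x y : ℝ} (hx : x ∈ Icc 0 L)
    (hy : y ∈ Icc 0 L) : IntervalIntegrable f' volume x y :=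
  (h.integrableOn.mono_set (ordConnected_Icc.uIcc_subset hx hy)).intervalIntegrable

theorem sub_eq_integral (h : IsPrimitive L f f') {x y : ℝ} (hx : x ∈ Icc 0 L)
    (hy : y ∈ Icc 0 L) : f x - f y = ∫ t in y..x, f' t := by
  have h0 : (0 : ℝ) ∈ Icc 0 L := ⟨le_rfl, hx.1.trans hx.2⟩
  rw [h.eq_add_integral x hx, h.eq_add_integral y hy, add_sub_add_left_eq_sub,
    integral_interval_sub_left (h.intervalIntegrable h0 hx) (h.intervalIntegrable h0 hy)]

theorem absolutelyContinuousOnInterval (h : IsPrimitive L f f') (hL : 0 ≤ L) :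
    AbsolutelyContinuousOnInterval f 0 L := by
  have hnorm : IntervalIntegrable (fun t => ‖f' t‖) volume 0 L :=
    (h.intervalIntegrable (left_mem_Icc.2 hL) (right_mem_Icc.2 hL)).norm
  have hac := hnorm.absolutelyContinuousOnInterval_intervalIntegral (c := 0) left_mem_uIcc
  rw [absolutelyContinuousOnInterval_iff] at hac ⊢
  intro ε hε
  obtain ⟨δ, hδ, hsum⟩ := hac ε hε
  refine ⟨δ, hδ, fun I hI hlt => (Finset.sum_le_sum fun i hi => ?_).trans_lt (hsum I hI hlt)⟩
  obtain ⟨hx, hy⟩ := hI.1 i hi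
  have hsub : ∀ {x}, x ∈ uIcc 0 L → IntervalIntegrable (fun t => ‖f' t‖) volume 0 x :=
    fun hx => hnorm.mono_set (uIcc_subset_uIcc_left hx)
  rw [dist_eq_norm, Real.dist_eq, integral_interval_sub_left (hsub hx) (hsub hy)]
  rw [uIcc_of_le hL] at hx hy
  rw [h.sub_eq_integral hx hy]
  exact norm_integral_le_abs_integral_norm

theorem continuousOn (h : IsPrimitive L f f') : ContinuousOn f (Icc 0 L) := by
  rcases le_or_gt 0 L with hL | hL
  · simpa only [uIcc_of_le hL] using (h.absolutelyContinuousOnInterval hL).continuousOn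
  · rw [Icc_eq_empty hL.not_ge]
    exact continuousOn_empty f

theorem ae_hasDerivAt [CompleteSpace E] (h : IsPrimitive L f f') (hL : 0 ≤ L) :
    ∀ᵐ x, x ∈ Icc 0 L → HasDerivAt f (f' x) x := by
  have hint := h.intervalIntegrable (left_mem_Icc.2 hL) (right_mem_Icc.2 hL)
  filter_upwards [hint.ae_hasDerivAt_integral, Measure.ae_ne volume 0, Measure.ae_ne volume L]
    with x hx hx0 hxL hxI
  rw [uIcc_of_le hL] at hx
  refine ((hx hxI 0 (left_mem_Icc.2 hL)).const_add (f 0)).congr_of_eventuallyEq ?_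
  filter_upwards [Icc_mem_nhds (hxI.1.lt_of_ne' hx0) (hxI.2.lt_of_ne hxL)] with y hy
  exact h.eq_add_integral y hy

theorem ae_eq_zero_of_eqOn_const [CompleteSpace E] (h : IsPrimitive L f f') (hL : 0 ≤ L) {z : E}
    (hf : ∀ x ∈ Icc 0 L, f x = z) : f' =ᵐ[volume.restrict (Icc 0 L)] 0 := by
  rw [Filter.EventuallyEq, ae_restrict_iff' measurableSet_Icc]
  filter_upwards [h.ae_hasDerivAt hL, Measure.ae_ne volume 0, Measure.ae_ne volume L]
    with x hx hx0 hxL hxI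
  refine (hx hxI).unique ((hasDerivAt_const x z).congr_of_eventuallyEq ?_)
  filter_upwards [Icc_mem_nhds (hxI.1.lt_of_ne' hx0) (hxI.2.lt_of_ne hxL)] with y hy
  exact hf y hy

theorem comp_conj {f f' : ℝ → ℂ} (h : IsPrimitive L f f') :
    IsPrimitive L (fun x => conj (f x)) fun x => conj (f' x) where
  integrableOn := (LinearIsometryEquiv.integrable_comp_iff Complex.conjLIE).2 h.integrableOn
  eq_add_integral x hx := by
    rw [h.eq_add_integral x hx, map_add, integral_of_le hx.1, integral_of_le hx.1, integral_conj]

/-- The product is absolutely continuous, so it is a primitive of its a.e. derivative. -/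
theorem mul {f f' g g' : ℝ → ℂ} (hf : IsPrimitive L f f') (hg : IsPrimitive L g g')
    (hL : 0 ≤ L) : IsPrimitive L (f * g) (f' * g + f * g') := by
  have hint : IntegrableOn (f' * g + f * g') (Icc 0 L) :=
    (hf.integrableOn.mul_continuousOn hg.continuousOn isCompact_Icc).add
      (hg.integrableOn.continuousOn_mul hf.continuousOn isCompact_Icc)
  have hprim : IsPrimitive L (fun x => ∫ t in (0 : ℝ)..x, (f' * g + f * g') t) (f' * g + f * g') :=
    ⟨hint, fun x _ => by simp⟩
  refine ⟨hint, fun x hx => ?_⟩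
  let D : ℝ → ℂ := fun x => f x * g x - ∫ t in (0 : ℝ)..x, (f' * g + f * g') t
  have hD : AbsolutelyContinuousOnInterval D 0 L :=
    ((hf.absolutelyContinuousOnInterval hL).fun_smul
      (hg.absolutelyContinuousOnInterval hL)).fun_sub (hprim.absolutelyContinuousOnInterval hL)
  have hD' : ∀ᵐ x, x ∈ uIcc 0 L → HasDerivAt D 0 x := by
    filter_upwards [hf.ae_hasDerivAt hL, hg.ae_hasDerivAt hL, hprim.ae_hasDerivAt hL]
      with x hfx hgx hpx hx
    rw [uIcc_of_le hL] at hx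
    have hDx := ((hfx hx).fun_mul (hgx hx)).fun_sub (hpx hx)
    simp only [Pi.add_apply, Pi.mul_apply, sub_self] at hDx
    exact hDx
  obtain ⟨z, hz⟩ := hD.const_of_ae_hasDerivAt_zero hD'
  have hDx : D x = D 0 := (hz x (by rwa [uIcc_of_le hL])).trans (hz 0 left_mem_uIcc).symm
  simp only [D, integral_same, sub_zero] at hDx
  exact sub_eq_iff_eq_add.1 hDx

end IsPrimitive

theorem sq_integral_le_mul_integral_sq {f : ℝ → ℝ} {a b : ℝ} (hab : a ≤ b)
    (hf : ContinuousOn f (Icc a b)) :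
    (∫ t in a..b, f t) ^ 2 ≤ (b - a) * ∫ t in a..b, f t ^ 2 := by
  rcases hab.eq_or_lt with rfl | hlt
  · simp
  rw [← uIcc_of_le hab] at hf
  have hfi : IntervalIntegrable f volume a b := hf.intervalIntegrable
  have hf2i : IntervalIntegrable (fun t => f t ^ 2) volume a b := (hf.pow 2).intervalIntegrable
  set m := (∫ t in a..b, f t) / (b - a)
  have hmean : m * (b - a) = ∫ t in a..b, f t := div_mul_cancel₀ _ (sub_pos.2 hlt).ne'
  have hvar : 0 ≤ ∫ t in a..b, (f t - m) ^ 2 := integral_nonneg hab fun t _ => sq_nonneg _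
  have hexpand : ∫ t in a..b, (f t - m) ^ 2 =
      (∫ t in a..b, f t ^ 2) - 2 * m * (∫ t in a..b, f t) + m ^ 2 * (b - a) := by
    have hsq : ∀ t, (f t - m) ^ 2 = f t ^ 2 - 2 * m * f t + m ^ 2 := fun t => by ring
    simp only [hsq]
    rw [integral_add (hf2i.sub (hfi.const_mul _)) intervalIntegrable_const,
      integral_sub hf2i (hfi.const_mul _), intervalIntegral.integral_const_mul,
      intervalIntegral.integral_const, smul_eq_mul]
    ring
  rw [hexpand] at hvar
  nlinarith [hvar, hmean, sub_pos.2 hlt]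

namespace IsSobolevH2

variable {L : ℝ} {u u' u'' v v' v'' : ℝ → ℂ}

theorem isPrimitive_deriv (h : IsSobolevH2 L u u' u'') : IsPrimitive L u' u'' :=
  ⟨h.memLp.integrable one_le_two, h.deriv_eq⟩

theorem isPrimitive (h : IsSobolevH2 L u u' u'') : IsPrimitive L u u' :=
  ⟨h.continuousOn_fst.integrableOn_Icc, h.eq⟩

theorem continuousOn (h : IsSobolevH2 L u u' u'') : ContinuousOn u (Icc 0 L) :=
  h.isPrimitive.continuousOn

theorem green (hL : 0 ≤ L) (h : IsSobolevH2 L u u' u'') (k : IsSobolevH2 L v v' v'')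
    {q : ℝ → ℂ} (hq : IntegrableOn q (Icc 0 L)) :
    ∫ t in (0 : ℝ)..L, (-u'' t + q t * u t) * conj (v t) =
      (∫ t in (0 : ℝ)..L, (u' t * conj (v' t) + q t * (u t * conj (v t)))) +
        (u' 0 * conj (v 0) + -u' L * conj (v L)) := by
  have hprod := h.isPrimitive_deriv.mul k.isPrimitive.comp_conj hL
  have hparts := hprod.eq_add_integral L (right_mem_Icc.2 hL)
  have hu'v' : IntervalIntegrable (fun t => u' t * conj (v' t)) volume 0 L :=
    (h.continuousOn_fst.mul k.continuousOn_fst.star).intervalIntegrable_of_Icc hL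
  have hquv : IntervalIntegrable (fun t => q t * (u t * conj (v t))) volume 0 L :=
    (intervalIntegrable_iff_integrableOn_Icc_of_le hL).2
      (hq.mul_continuousOn (h.continuousOn.mul k.continuousOn.star) isCompact_Icc)
  have hsub := integral_sub (hu'v'.add hquv)
    (hprod.intervalIntegrable (left_mem_Icc.2 hL) (right_mem_Icc.2 hL))
  have hpointwise : ∀ t, (-u'' t + q t * u t) * conj (v t) =
      (u' t * conj (v' t) + q t * (u t * conj (v t))) -
        ((u'' * (fun x => conj (v x)) + u' * fun x => conj (v' x)) t) := fun t => by
    simp only [Pi.add_apply, Pi.mul_apply]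
    ring
  simp only [hpointwise]
  simp only [Pi.mul_apply] at hparts
  linear_combination hsub + hparts

theorem norm_sub_sq_le (h : IsSobolevH2 L u u' u'') {x y : ℝ} (hx : x ∈ Icc 0 L)
    (hy : y ∈ Icc 0 L) : ‖u x - u y‖ ^ 2 ≤ |x - y| * ∫ t in (0 : ℝ)..L, ‖u' t‖ ^ 2 := by
  wlog hxy : y ≤ x generalizing x y
  · rw [norm_sub_rev, abs_sub_comm]
    exact this hy hx (le_of_not_ge hxy)
  rw [abs_of_nonneg (sub_nonneg.2 hxy), h.isPrimitive.sub_eq_integral hx hy]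
  calc ‖∫ t in y..x, u' t‖ ^ 2 ≤ (∫ t in y..x, ‖u' t‖) ^ 2 := by
        gcongr
        exact norm_integral_le_integral_norm hxy
    _ ≤ (x - y) * ∫ t in y..x, ‖u' t‖ ^ 2 := sq_integral_le_mul_integral_sq hxy
        (h.continuousOn_fst.norm.mono (Icc_subset_Icc hy.1 hx.2))
    _ ≤ (x - y) * ∫ t in (0 : ℝ)..L, ‖u' t‖ ^ 2 :=
        mul_le_mul_of_nonneg_left (integral_mono_interval hy.1 hxy hx.2
          (Filter.Eventually.of_forall fun t => sq_nonneg _)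
          ((h.continuousOn_fst.norm.pow 2).intervalIntegrable_of_Icc (hx.1.trans hx.2)))
          (sub_nonneg.2 hxy)

theorem norm_sq_le_add (h : IsSobolevH2 L u u' u'') {x y : ℝ} (hx : x ∈ Icc 0 L)
    (hy : y ∈ Icc 0 L) :
    ‖u x‖ ^ 2 ≤ 2 * ‖u y‖ ^ 2 + 2 * (|x - y| * ∫ t in (0 : ℝ)..L, ‖u' t‖ ^ 2) := calc
  ‖u x‖ ^ 2 = ‖u y + (u x - u y)‖ ^ 2 := by rw [add_sub_cancel]
  _ ≤ (‖u y‖ + ‖u x - u y‖) ^ 2 := by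
    gcongr
    exact norm_add_le _ _
  _ ≤ 2 * (‖u y‖ ^ 2 + ‖u x - u y‖ ^ 2) := add_sq_le
  _ ≤ 2 * ‖u y‖ ^ 2 + 2 * (|x - y| * ∫ t in (0 : ℝ)..L, ‖u' t‖ ^ 2) := by
    linarith [h.norm_sub_sq_le hx hy]

theorem mul_norm_sq_le (h : IsSobolevH2 L u u' u'') {δ : ℝ} (hδ : 0 ≤ δ) (hδL : δ ≤ L) {x : ℝ}
    (hx : x ∈ Icc 0 L) :
    δ * ‖u x‖ ^ 2 ≤ 2 * (∫ t in (0 : ℝ)..L, ‖u t‖ ^ 2) +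
      δ * (2 * (δ * ∫ t in (0 : ℝ)..L, ‖u' t‖ ^ 2)) := by
  have hL : 0 ≤ L := hδ.trans hδL
  set D := ∫ t in (0 : ℝ)..L, ‖u' t‖ ^ 2
  have hD : 0 ≤ D := integral_nonneg hL fun t _ => sq_nonneg _
  -- Average the bound by `u y` over `y` in a subinterval `[a, a + δ]` that contains `x`.
  obtain ⟨a, ha, hax, hxa, haL⟩ : ∃ a, 0 ≤ a ∧ a ≤ x ∧ x ≤ a + δ ∧ a + δ ≤ L := by
    rcases le_total x (L - δ) with hle | hle
    · exact ⟨x, hx.1, le_rfl, by linarith, by linarith⟩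
    · exact ⟨L - δ, by linarith, hle, by linarith [hx.2], by linarith⟩
  have hsq : IntervalIntegrable (fun t => ‖u t‖ ^ 2) volume 0 L :=
    (h.continuousOn.norm.pow 2).intervalIntegrable_of_Icc hL
  have hsq' : IntervalIntegrable (fun t => ‖u t‖ ^ 2) volume a (a + δ) :=
    ((h.continuousOn.norm.pow 2).mono (Icc_subset_Icc ha haL)).intervalIntegrable_of_Icc
      (by linarith)
  calc δ * ‖u x‖ ^ 2 = ∫ _ in a..(a + δ), ‖u x‖ ^ 2 := by
        rw [intervalIntegral.integral_const, add_sub_cancel_left, smul_eq_mul]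
    _ ≤ ∫ y in a..(a + δ), (2 * ‖u y‖ ^ 2 + 2 * (δ * D)) := by
        refine integral_mono_on (by linarith) intervalIntegrable_const
          ((hsq'.const_mul 2).add intervalIntegrable_const) fun y hy => ?_
        have hxy : |x - y| ≤ δ := abs_le.2 ⟨by linarith [hy.2], by linarith [hy.1]⟩
        have hmul := mul_le_mul_of_nonneg_right hxy hD
        linarith [h.norm_sq_le_add hx (y := y) ⟨ha.trans hy.1, hy.2.trans haL⟩]
    _ = 2 * (∫ y in a..(a + δ), ‖u y‖ ^ 2) + δ * (2 * (δ * D)) := by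
        rw [integral_add (hsq'.const_mul 2) intervalIntegrable_const,
          intervalIntegral.integral_const, intervalIntegral.integral_const_mul,
          add_sub_cancel_left, smul_eq_mul]
    _ ≤ 2 * (∫ t in (0 : ℝ)..L, ‖u t‖ ^ 2) + δ * (2 * (δ * D)) := by
        gcongr
        exact integral_mono_interval ha (by linarith) haL
          (Filter.Eventually.of_forall fun t => sq_nonneg _) hsq

theorem exists_norm_sq_le (hL : 0 < L) {ε : ℝ} (hε : 0 < ε) :
    ∃ C, ∀ u u' u'' : ℝ → ℂ, IsSobolevH2 L u u' u'' → ∀ x ∈ Icc 0 L,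
      ‖u x‖ ^ 2 ≤ ε * (∫ t in (0 : ℝ)..L, ‖u' t‖ ^ 2) + C * ∫ t in (0 : ℝ)..L, ‖u t‖ ^ 2 := by
  set δ := min L (ε / 2)
  have hδ : 0 < δ := lt_min hL (half_pos hε)
  have hδε : 2 * δ ≤ ε := by linarith [min_le_right L (ε / 2)]
  refine ⟨2 / δ, fun u u' u'' h x hx => le_of_mul_le_mul_left ?_ hδ⟩
  set D := ∫ t in (0 : ℝ)..L, ‖u' t‖ ^ 2
  set N := ∫ t in (0 : ℝ)..L, ‖u t‖ ^ 2
  have hD : 0 ≤ D := integral_nonneg hL.le fun t _ => sq_nonneg _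
  calc δ * ‖u x‖ ^ 2 ≤ 2 * N + δ * (2 * (δ * D)) := h.mul_norm_sq_le hδ.le (min_le_left _ _) hx
    _ = δ * (2 * δ * D + 2 / δ * N) := by
        field_simp
        ring
    _ ≤ δ * (ε * D + 2 / δ * N) := by gcongr

theorem neg_mul_le_integral_mul_norm_sq (h : IsSobolevH2 L u u' u'') (hL : 0 ≤ L) {q : ℝ → ℝ}
    (hq : IntegrableOn q (Icc 0 L)) {S : ℝ} (hS : ∀ x ∈ Icc 0 L, ‖u x‖ ^ 2 ≤ S) :
    -((∫ t in (0 : ℝ)..L, |q t|) * S) ≤ ∫ t in (0 : ℝ)..L, q t * ‖u t‖ ^ 2 := by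
  have hqi : IntervalIntegrable q volume 0 L :=
    (intervalIntegrable_iff_integrableOn_Icc_of_le hL).2 hq
  have hcont : ContinuousOn (fun t => ‖u t‖ ^ 2) (uIcc 0 L) := by
    rw [uIcc_of_le hL]
    exact h.continuousOn.norm.pow 2
  rw [← intervalIntegral.integral_mul_const, ← intervalIntegral.integral_neg]
  refine integral_mono_on hL (hqi.abs.mul_const _).neg (hqi.mul_continuousOn hcont) fun t ht => ?_
  calc -(|q t| * S) ≤ -(|q t| * ‖u t‖ ^ 2) := by
        gcongr
        exact hS t ht
    _ ≤ q t * ‖u t‖ ^ 2 := by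
        rw [← neg_mul]
        gcongr
        exact neg_abs_le _

theorem integral_form_eq (h : IsSobolevH2 L u u' u'') (hL : 0 ≤ L) {q : ℝ → ℝ}
    (hq : IntegrableOn q (Icc 0 L)) (c : ℝ) :
    ∫ t in (0 : ℝ)..L, (‖u' t‖ ^ 2 + (q t + c) * ‖u t‖ ^ 2) =
      (∫ t in (0 : ℝ)..L, ‖u' t‖ ^ 2) + (∫ t in (0 : ℝ)..L, q t * ‖u t‖ ^ 2) +
        c * ∫ t in (0 : ℝ)..L, ‖u t‖ ^ 2 := by
  have hu : IntervalIntegrable (fun t => ‖u t‖ ^ 2) volume 0 L :=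
    (h.continuousOn.norm.pow 2).intervalIntegrable_of_Icc hL
  have hu' : IntervalIntegrable (fun t => ‖u' t‖ ^ 2) volume 0 L :=
    (h.continuousOn_fst.norm.pow 2).intervalIntegrable_of_Icc hL
  have hqu : IntervalIntegrable (fun t => q t * ‖u t‖ ^ 2) volume 0 L :=
    (intervalIntegrable_iff_integrableOn_Icc_of_le hL).2
      (hq.mul_continuousOn (h.continuousOn.norm.pow 2) isCompact_Icc)
  simp only [add_mul, ← add_assoc]
  rw [integral_add (hu'.add hqu) (hu.const_mul c), integral_add hu' hqu,
    intervalIntegral.integral_const_mul]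

/-- By Sobolev's trace inequality, the potential and the boundary values are form bounded with
respect to the Dirichlet integral, with arbitrarily small relative bound. -/
theorem exists_form_bound (hL : 0 < L) {q : ℝ → ℝ} (hq : IntegrableOn q (Icc 0 L)) {C : ℝ}
    (hC : 0 ≤ C) :
    ∃ c₀, ∀ c ≥ c₀, ∀ u u' u'' : ℝ → ℂ, IsSobolevH2 L u u' u'' →
      C * (‖u 0‖ ^ 2 + ‖u L‖ ^ 2) + ∫ t in (0 : ℝ)..L, ‖u t‖ ^ 2 ≤
        ∫ t in (0 : ℝ)..L, (‖u' t‖ ^ 2 + (q t + c) * ‖u t‖ ^ 2) := by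
  set Q := ∫ t in (0 : ℝ)..L, |q t|
  have hQ : 0 ≤ Q := integral_nonneg hL.le fun t _ => abs_nonneg _
  obtain ⟨K, hK⟩ := exists_norm_sq_le hL (ε := 1 / (Q + 2 * C + 1)) (by positivity)
  refine ⟨(Q + 2 * C) * K + 1, fun c hc u u' u'' h => ?_⟩
  rw [h.integral_form_eq hL.le hq]
  set D := ∫ t in (0 : ℝ)..L, ‖u' t‖ ^ 2
  set N := ∫ t in (0 : ℝ)..L, ‖u t‖ ^ 2
  have hD : 0 ≤ D := integral_nonneg hL.le fun t _ => sq_nonneg _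
  have hN : 0 ≤ N := integral_nonneg hL.le fun t _ => sq_nonneg _
  set S := 1 / (Q + 2 * C + 1) * D + K * N
  have hS : ∀ x ∈ Icc 0 L, ‖u x‖ ^ 2 ≤ S := hK u u' u'' h
  have hpotential := h.neg_mul_le_integral_mul_norm_sq hL.le hq hS
  have hboundary : C * (‖u 0‖ ^ 2 + ‖u L‖ ^ 2) ≤ C * (S + S) := by
    gcongr
    exacts [hS 0 (left_mem_Icc.2 hL.le), hS L (right_mem_Icc.2 hL.le)]
  have habsorb : (Q + 2 * C) * S ≤ D + (Q + 2 * C) * K * N := by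
    have hle : (Q + 2 * C) * (1 / (Q + 2 * C + 1)) ≤ 1 := by
      rw [mul_one_div, div_le_one (by positivity)]
      linarith
    calc (Q + 2 * C) * S = (Q + 2 * C) * (1 / (Q + 2 * C + 1)) * D + (Q + 2 * C) * K * N := by
          ring
      _ ≤ D + (Q + 2 * C) * K * N := by
          gcongr
          exact mul_le_of_le_one_left hD hle
  have hshift : ((Q + 2 * C) * K + 1) * N ≤ c * N := mul_le_mul_of_nonneg_right hc hN
  linarith

theorem eqOn_zero_of_eqOn_zero (h : IsSobolevH2 L u u' u'') (hL : 0 < L)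
    (hu : ∀ x ∈ Icc 0 L, u x = 0) : ∀ x ∈ Icc 0 L, u' x = 0 :=
  Measure.eqOn_Icc_of_ae_eq volume hL.ne (h.isPrimitive.ae_eq_zero_of_eqOn_const hL.le hu)
    h.continuousOn_fst continuousOn_const

theorem ae_eq_zero_of_eqOn_zero (h : IsSobolevH2 L u u' u'') (hL : 0 < L)
    (hu : ∀ x ∈ Icc 0 L, u x = 0) : u'' =ᵐ[volume.restrict (Icc 0 L)] 0 :=
  h.isPrimitive_deriv.ae_eq_zero_of_eqOn_const hL.le (h.eqOn_zero_of_eqOn_zero hL hu)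

end IsSobolevH2

end Interval

noncomputable section IntervalData

open Set

open scoped BoundedContinuousFunction

/-- The triples `(u'', u(0), u'(0))` that parametrise the Sobolev space `H²(0, L)`. -/
abbrev IntervalData (L : ℝ) : Type := Lp ℂ 2 (volume.restrict (Icc 0 L)) × ℂ × ℂ

namespace IntervalData

variable {L : ℝ}

/-- The first derivative of the Sobolev function with data `p`. -/
def deriv (p : IntervalData L) (x : ℝ) : ℂ := p.2.2 + ∫ t in (0 : ℝ)..x, p.1 t

/-- The Sobolev function with data `p`. -/
def fn (p : IntervalData L) (x : ℝ) : ℂ := p.2.1 + ∫ t in (0 : ℝ)..x, p.deriv t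

@[simp]
theorem deriv_zero (p : IntervalData L) : p.deriv 0 = p.2.2 := by simp [deriv]

@[simp]
theorem fn_zero (p : IntervalData L) : p.fn 0 = p.2.1 := by simp [fn]

theorem isSobolevH2 (p : IntervalData L) : IsSobolevH2 L p.fn p.deriv p.1 where
  memLp := Lp.memLp p.1
  deriv_eq x _ := by rw [deriv_zero, deriv]
  eq x _ := by rw [fn_zero, fn]

/-- The indicator function of `(0, x]` in `L²(0, L)`, against which the inner product is the
integral over `[0, x]`. -/
def indicatorIoc (L x : ℝ) : Lp ℂ 2 (volume.restrict (Icc 0 L)) :=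
  indicatorConstLp 2 (measurableSet_Ioc (a := 0) (b := x)) (measure_ne_top _ _) 1

theorem integral_eq_inner (w : Lp ℂ 2 (volume.restrict (Icc 0 L))) {x : ℝ} (hx : x ∈ Icc 0 L) :
    ∫ t in (0 : ℝ)..x, w t = inner ℂ (indicatorIoc L x) w := by
  rw [indicatorIoc, L2.inner_indicatorConstLp_one, Measure.restrict_restrict measurableSet_Ioc,
    intervalIntegral.integral_of_le hx.1, inter_eq_left.2]
  exact Ioc_subset_Icc_self.trans (Icc_subset_Icc_right hx.2)

theorem norm_indicatorIoc_le (hL : 0 ≤ L) (x : ℝ) : ‖indicatorIoc L x‖ ≤ √L := by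
  rw [indicatorIoc, norm_indicatorConstLp (by norm_num) (by norm_num), norm_one, one_mul,
    Real.sqrt_eq_rpow, ENNReal.toReal_ofNat]
  refine Real.rpow_le_rpow measureReal_nonneg ?_ (by norm_num)
  calc (volume.restrict (Icc 0 L)).real (Ioc 0 x) ≤ (volume.restrict (Icc 0 L)).real univ :=
        measureReal_mono (subset_univ _)
    _ = L := by simp [measureReal_restrict_apply, hL]

/-- The derivative at a point, as a continuous linear functional of the data. -/
def derivL (L x : ℝ) : IntervalData L →L[ℂ] ℂ :=
  (ContinuousLinearMap.snd ℂ ℂ ℂ).comp (ContinuousLinearMap.snd ℂ _ _) +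
    (innerSL ℂ (indicatorIoc L x)).comp (ContinuousLinearMap.fst ℂ _ _)

theorem derivL_apply (p : IntervalData L) {x : ℝ} (hx : x ∈ Icc 0 L) :
    derivL L x p = p.deriv x := by
  rw [deriv, integral_eq_inner _ hx]
  rfl

theorem norm_deriv_le (p : IntervalData L) {x : ℝ} (hx : x ∈ Icc 0 L) :
    ‖p.deriv x‖ ≤ (1 + √L) * ‖p‖ := calc
  ‖p.deriv x‖ ≤ ‖p.2.2‖ + ‖∫ t in (0 : ℝ)..x, p.1 t‖ := norm_add_le _ _
  _ ≤ ‖p‖ + √L * ‖p‖ := by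
    refine add_le_add ((norm_snd_le p.2).trans (norm_snd_le p)) ?_
    rw [integral_eq_inner _ hx]
    exact (norm_inner_le_norm _ _).trans (mul_le_mul
      (norm_indicatorIoc_le (hx.1.trans hx.2) x) (norm_fst_le p) (norm_nonneg _)
      (Real.sqrt_nonneg _))
  _ = (1 + √L) * ‖p‖ := by ring

theorem fn_add (p r : IntervalData L) {x : ℝ} (hx : x ∈ Icc 0 L) :
    (p + r).fn x = p.fn x + r.fn x := by
  have hderiv : ∀ t ∈ uIcc 0 x, (p + r).deriv t = p.deriv t + r.deriv t := fun t ht => by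
    rw [uIcc_of_le hx.1] at ht
    simp only [← derivL_apply _ (Icc_subset_Icc_right hx.2 ht), map_add]
  rw [fn, intervalIntegral.integral_congr hderiv, intervalIntegral.integral_add
    (p.isSobolevH2.intervalIntegrable_fst hx) (r.isSobolevH2.intervalIntegrable_fst hx),
    Prod.snd_add, Prod.fst_add, add_add_add_comm]
  rfl

theorem fn_smul (z : ℂ) (p : IntervalData L) {x : ℝ} (hx : x ∈ Icc 0 L) :
    (z • p).fn x = z • p.fn x := by
  have hderiv : ∀ t ∈ uIcc 0 x, (z • p).deriv t = z • p.deriv t := fun t ht => by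
    rw [uIcc_of_le hx.1] at ht
    simp only [← derivL_apply _ (Icc_subset_Icc_right hx.2 ht), map_smul]
  rw [fn, intervalIntegral.integral_congr hderiv, intervalIntegral.integral_smul, Prod.smul_snd,
    Prod.smul_fst, ← smul_add]
  rfl

theorem norm_fn_sub_le (p : IntervalData L) {x y : ℝ} (hx : x ∈ Icc 0 L) (hy : y ∈ Icc 0 L) :
    ‖p.fn x - p.fn y‖ ≤ (1 + √L) * ‖p‖ * |x - y| := by
  rw [p.isSobolevH2.isPrimitive.sub_eq_integral hx hy]
  exact intervalIntegral.norm_integral_le_of_norm_le_const fun t ht =>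
    p.norm_deriv_le (ordConnected_Icc.uIcc_subset hy hx (uIoc_subset_uIcc ht))

theorem norm_fn_le (p : IntervalData L) {x : ℝ} (hx : x ∈ Icc 0 L) :
    ‖p.fn x‖ ≤ (1 + (1 + √L) * L) * ‖p‖ := calc
  ‖p.fn x‖ = ‖p.fn 0 + (p.fn x - p.fn 0)‖ := by rw [add_sub_cancel]
  _ ≤ ‖p.fn 0‖ + ‖p.fn x - p.fn 0‖ := norm_add_le _ _
  _ ≤ ‖p‖ + (1 + √L) * ‖p‖ * L := by
    refine add_le_add ?_ ((p.norm_fn_sub_le hx (left_mem_Icc.2 (hx.1.trans hx.2))).trans ?_)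
    · rw [fn_zero]
      exact (norm_fst_le p.2).trans (norm_snd_le p)
    · rw [sub_zero, abs_of_nonneg hx.1]
      exact mul_le_mul_of_nonneg_left hx.2 (by positivity)
  _ = (1 + (1 + √L) * L) * ‖p‖ := by ring

/-- The Sobolev function as a bounded continuous function on `[0, L]`. -/
def fnL (hL : 0 ≤ L) : IntervalData L →L[ℂ] (Icc 0 L →ᵇ ℂ) :=
  LinearMap.mkContinuous
    { toFun := fun p => BoundedContinuousFunction.mkOfCompact
        ⟨fun x : Icc 0 L => p.fn x,
          continuousOn_iff_continuous_domRestrict.1 p.isSobolevH2.continuousOn⟩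
      map_add' := fun p r => BoundedContinuousFunction.ext fun x => fn_add p r x.2
      map_smul' := fun z p => BoundedContinuousFunction.ext fun x => fn_smul z p x.2 }
    (1 + (1 + √L) * L) fun p =>
      (BoundedContinuousFunction.norm_le (by positivity)).2 fun x => p.norm_fn_le x.2

@[simp]
theorem fnL_apply (hL : 0 ≤ L) (p : IntervalData L) (x : Icc 0 L) : fnL hL p x = p.fn x := rfl

theorem isCompactOperator_fnL (hL : 0 ≤ L) : IsCompactOperator (fnL hL) := by
  refine (isCompactOperator_iff_isCompact_closure_image_closedBall
    (fnL hL : IntervalData L →ₗ[ℂ] (Icc 0 L →ᵇ ℂ)) one_pos).2 ?_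
  refine BoundedContinuousFunction.arzela_ascoli
    (Metric.closedBall (0 : ℂ) (1 + (1 + √L) * L)) (isCompact_closedBall _ _) _ ?_ ?_
  · rintro _ x ⟨p, hp, rfl⟩
    rw [mem_closedBall_zero_iff] at hp ⊢
    exact (p.norm_fn_le x.2).trans (mul_le_of_le_one_right (by positivity) hp)
  · refine (LipschitzWith.uniformEquicontinuous _ (Real.toNNReal (1 + √L)) ?_).equicontinuous
    rintro ⟨_, p, hp, rfl⟩
    rw [mem_closedBall_zero_iff] at hp
    refine LipschitzWith.of_dist_le_mul fun x y => ?_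
    rw [Real.coe_toNNReal _ (by positivity), dist_eq_norm, Subtype.dist_eq, Real.dist_eq]
    refine (p.norm_fn_sub_le x.2 y.2).trans (mul_le_mul_of_nonneg_right ?_ (abs_nonneg _))
    exact mul_le_of_le_one_right (by positivity) hp

theorem memLp_mul_IccExtend (hL : 0 ≤ L) {q : ℝ → ℂ} (hq : MemLp q 2 (volume.restrict (Icc 0 L)))
    (φ : Icc 0 L →ᵇ ℂ) :
    MemLp (fun x => q x * IccExtend hL φ x) 2 (volume.restrict (Icc 0 L)) := by
  refine hq.of_le_mul (c := ‖φ‖) ?_ (Filter.Eventually.of_forall fun x => ?_)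
  · exact hq.1.mul (φ.continuous.Icc_extend' (h := hL)).aestronglyMeasurable
  · rw [norm_mul, mul_comm]
    exact mul_le_mul_of_nonneg_right (φ.norm_coe_le_norm _) (norm_nonneg _)

/-- Multiplication of continuous functions by a square integrable function. -/
def mulL (hL : 0 ≤ L) {q : ℝ → ℂ} (hq : MemLp q 2 (volume.restrict (Icc 0 L))) :
    (Icc 0 L →ᵇ ℂ) →L[ℂ] Lp ℂ 2 (volume.restrict (Icc 0 L)) :=
  LinearMap.mkContinuous
    { toFun := fun φ => (memLp_mul_IccExtend hL hq φ).toLp _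
      map_add' := fun φ ψ => by
        rw [← MemLp.toLp_add]
        exact MemLp.toLp_congr _ _ (Filter.Eventually.of_forall fun x => mul_add _ _ _)
      map_smul' := fun z φ => by
        rw [RingHom.id_apply, ← MemLp.toLp_const_smul]
        exact MemLp.toLp_congr _ _ (Filter.Eventually.of_forall fun x => mul_left_comm _ _ _) }
    ‖hq.toLp q‖ fun φ => by
      refine (Lp.norm_le_mul_norm_of_ae_le_mul ?_).trans_eq (mul_comm _ _)
      filter_upwards [(memLp_mul_IccExtend hL hq φ).coeFn_toLp, hq.coeFn_toLp] with x hx hqx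
      refine (congrArg norm hx).trans_le ?_
      rw [hqx, norm_mul, mul_comm]
      exact mul_le_mul_of_nonneg_right (φ.norm_coe_le_norm _) (norm_nonneg _)

theorem mulL_fnL_ae_eq (hL : 0 ≤ L) {q : ℝ → ℂ} (hq : MemLp q 2 (volume.restrict (Icc 0 L)))
    (p : IntervalData L) :
    mulL hL hq (fnL hL p) =ᵐ[volume.restrict (Icc 0 L)] fun x => q x * p.fn x := by
  have hext : mulL hL hq (fnL hL p) =ᵐ[volume.restrict (Icc 0 L)]
      fun x => q x * IccExtend hL (fnL hL p) x :=
    (memLp_mul_IccExtend hL hq (fnL hL p)).coeFn_toLp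
  filter_upwards [hext, ae_restrict_mem measurableSet_Icc] with x hx hmem
  rw [hx, IccExtend_of_mem _ _ hmem, fnL_apply]

end IntervalData

end IntervalData

noncomputable section MetricEdges

open Set

open scoped ComplexConjugate InnerProductSpace Matrix

/-- A family of disjoint intervals carrying square integrable potentials: a quantum graph without
its vertices. -/
structure MetricEdges (E : Type*) where
  length : E → ℝ
  length_pos : ∀ e, 0 < length e
  potential : E → ℝ → ℝ
  potential_memLp : ∀ e, MemLp (potential e) 2 (volume.restrict (Icc 0 (length e)))

theorem isCompactOperator_pi {M ι : Type*} [TopologicalSpace M] [Zero M] [Finite ι] {N : ι → Type*}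
    [∀ i, TopologicalSpace (N i)] {f : ∀ i, M → N i} (hf : ∀ i, IsCompactOperator (f i)) :
    IsCompactOperator fun x i => f i x := by
  choose K hK hKf using hf
  refine ⟨Set.pi univ K, isCompact_univ_pi hK, ?_⟩
  filter_upwards [Filter.eventually_all.2 hKf] with x hx i _ using hx i

namespace MetricEdges

variable {E : Type*} (X : MetricEdges E)

/-- The Lebesgue measure on an interval of the family. -/
abbrev edgeMeasure (e : E) : Measure ℝ := volume.restrict (Icc 0 (X.length e))

/-- The orthogonal direct sum of the `L²` spaces of the intervals. -/
abbrev L2 : Type _ := PiLp 2 (fun e : E => Lp ℂ 2 (X.edgeMeasure e))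

/-- The data `(u'', u(0), u'(0))` that parametrise the functions in `H²` of all the intervals; the
numbers `u(0)` are indexed by `(e, false)` and the numbers `u'(0)` by `(e, true)`. -/
abbrev Data : Type _ := X.L2 × (E × Bool → ℂ)

/-- The restriction to one interval. -/
def edge (e : E) : X.Data →L[ℂ] IntervalData (X.length e) :=
  ((PiLp.proj 2 (𝕜 := ℂ) (fun e : E => Lp ℂ 2 (X.edgeMeasure e)) e).comp
      (ContinuousLinearMap.fst ℂ _ _)).prod
    (((ContinuousLinearMap.proj (R := ℂ) (φ := fun _ : E × Bool => ℂ) (e, false)).comp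
        (ContinuousLinearMap.snd ℂ _ _)).prod
      ((ContinuousLinearMap.proj (R := ℂ) (φ := fun _ : E × Bool => ℂ) (e, true)).comp
        (ContinuousLinearMap.snd ℂ _ _)))

theorem isSobolevH2 (p : X.Data) (e : E) :
    IsSobolevH2 (X.length e) (X.edge e p).fn (X.edge e p).deriv (p.1 e) :=
  (X.edge e p).isSobolevH2

/-- The family of the products `q e • u e`, where the `u e` are the functions with given data. -/
def mulPi {q : E → ℝ → ℂ} (hq : ∀ e, MemLp (q e) 2 (X.edgeMeasure e)) :
    X.Data →L[ℂ] ∀ e, Lp ℂ 2 (X.edgeMeasure e) :=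
  ContinuousLinearMap.pi fun e => (IntervalData.mulL (X.length_pos e).le (hq e)).comp
    ((IntervalData.fnL (X.length_pos e).le).comp (X.edge e))

/-- The operator that multiplies the functions with given data by square integrable functions. -/
def mulOp {q : E → ℝ → ℂ} (hq : ∀ e, MemLp (q e) 2 (X.edgeMeasure e)) : X.Data →L[ℂ] X.L2 :=
  ((PiLp.continuousLinearEquiv 2 ℂ (fun e : E => Lp ℂ 2 (X.edgeMeasure e))).symm :
    (∀ e : E, Lp ℂ 2 (X.edgeMeasure e)) →L[ℂ] X.L2).comp (X.mulPi hq)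

theorem mulOp_ae_eq {q : E → ℝ → ℂ} (hq : ∀ e, MemLp (q e) 2 (X.edgeMeasure e)) (p : X.Data)
    (e : E) : X.mulOp hq p e =ᵐ[X.edgeMeasure e] fun x => q e x * (X.edge e p).fn x :=
  IntervalData.mulL_fnL_ae_eq (X.length_pos e).le (hq e) (X.edge e p)

theorem isCompactOperator_mulOp [Finite E] {q : E → ℝ → ℂ}
    (hq : ∀ e, MemLp (q e) 2 (X.edgeMeasure e)) : IsCompactOperator (X.mulOp hq) := by
  have hpi : IsCompactOperator (X.mulPi hq) := isCompactOperator_pi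
    (f := fun e => ⇑((IntervalData.mulL (X.length_pos e).le (hq e)).comp
      ((IntervalData.fnL (X.length_pos e).le).comp (X.edge e)))) fun e =>
    ((IntervalData.isCompactOperator_fnL (X.length_pos e).le).comp_clm (X.edge e)).clm_comp
      (IntervalData.mulL (X.length_pos e).le (hq e))
  exact hpi.continuous_comp (PiLp.continuousLinearEquiv 2 ℂ _).symm.continuous

/-- The class in `L²` of the functions with given data. -/
def toL2 : X.Data →L[ℂ] X.L2 := X.mulOp fun _ => memLp_const 1

theorem toL2_ae_eq (p : X.Data) (e : E) : X.toL2 p e =ᵐ[X.edgeMeasure e] (X.edge e p).fn := by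
  filter_upwards [X.mulOp_ae_eq (fun _ => memLp_const 1) p e] with x hx
  rw [toL2, hx, one_mul]

theorem isCompactOperator_toL2 [Finite E] : IsCompactOperator X.toL2 := X.isCompactOperator_mulOp _

theorem toL2_injective : Function.Injective X.toL2 := by
  refine (injective_iff_map_eq_zero _).2 fun p h => ?_
  have hfn : ∀ e, ∀ x ∈ Icc 0 (X.length e), (X.edge e p).fn x = 0 := fun e x hx => by
    refine Measure.eqOn_Icc_of_ae_eq volume (X.length_pos e).ne ?_
      (X.isSobolevH2 p e).continuousOn continuousOn_const hx
    have hzero : X.toL2 p e = 0 := by rw [h, PiLp.zero_apply]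
    exact (X.toL2_ae_eq p e).symm.trans (hzero ▸ Lp.coeFn_zero ℂ 2 _)
  refine Prod.ext (PiLp.ext fun e => (Lp.eq_zero_iff_ae_eq_zero).2 <|
    (X.isSobolevH2 p e).ae_eq_zero_of_eqOn_zero (X.length_pos e) (hfn e)) (funext ?_)
  rintro ⟨e, _ | _⟩
  · exact (X.edge e p).fn_zero.symm.trans (hfn e 0 (left_mem_Icc.2 (X.length_pos e).le))
  · exact (X.edge e p).deriv_zero.symm.trans <| (X.isSobolevH2 p e).eqOn_zero_of_eqOn_zero
      (X.length_pos e) (hfn e) 0 (left_mem_Icc.2 (X.length_pos e).le)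

theorem not_finiteDimensional_L2 [Finite E] [Nonempty E] : ¬ FiniteDimensional ℂ X.L2 := by
  intro h
  have := Fintype.ofFinite E
  have hle := LinearMap.finrank_le_finrank_of_injective (f := (X.toL2 : X.Data →ₗ[ℂ] X.L2))
    X.toL2_injective
  rw [Module.finrank_prod, Module.finrank_fintype_fun_eq_card] at hle
  have hpos : 0 < Fintype.card (E × Bool) := Fintype.card_pos
  omega

/-- The values at the ends of the intervals. -/
def endValue : X.Data →L[ℂ] (E × Bool → ℂ) :=
  ContinuousLinearMap.pi fun b => (BoundedContinuousFunction.evalCLM ℂ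
    (if b.2 then ⟨X.length b.1, right_mem_Icc.2 (X.length_pos b.1).le⟩
      else ⟨0, left_mem_Icc.2 (X.length_pos b.1).le⟩ : Icc 0 (X.length b.1))).comp
    ((IntervalData.fnL (X.length_pos b.1).le).comp (X.edge b.1))

theorem endValue_true (p : X.Data) (e : E) :
    X.endValue p (e, true) = (X.edge e p).fn (X.length e) := rfl

theorem endValue_false (p : X.Data) (e : E) : X.endValue p (e, false) = (X.edge e p).fn 0 := rfl

/-- The inward derivatives at the ends of the intervals. -/
def endDeriv : X.Data →L[ℂ] (E × Bool → ℂ) :=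
  ContinuousLinearMap.pi fun b => if b.2
    then -(IntervalData.derivL (X.length b.1) (X.length b.1)).comp (X.edge b.1)
    else (IntervalData.derivL (X.length b.1) 0).comp (X.edge b.1)

theorem endDeriv_true (p : X.Data) (e : E) :
    X.endDeriv p (e, true) = -(X.edge e p).deriv (X.length e) := by
  rw [← IntervalData.derivL_apply _ (right_mem_Icc.2 (X.length_pos e).le)]
  rfl

theorem endDeriv_false (p : X.Data) (e : E) :
    X.endDeriv p (e, false) = (X.edge e p).deriv 0 := by
  rw [← IntervalData.derivL_apply _ (left_mem_Icc.2 (X.length_pos e).le)]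
  rfl

/-- The pair of the values and the inward derivatives at the ends of the intervals. -/
def trace : X.Data →L[ℂ] (E × Bool → ℂ) × (E × Bool → ℂ) := X.endValue.prod X.endDeriv

theorem potential_ofReal_memLp (e : E) :
    MemLp (fun x => (X.potential e x : ℂ)) 2 (X.edgeMeasure e) := (X.potential_memLp e).ofReal

variable [Fintype E]

/-- Multiplication by the shifted potential `V + c`. -/
def potOp (c : ℝ) : X.Data →L[ℂ] X.L2 := X.mulOp X.potential_ofReal_memLp + (c : ℂ) • X.toL2

theorem isCompactOperator_potOp (c : ℝ) : IsCompactOperator (X.potOp c) :=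
  (X.isCompactOperator_mulOp _).add (X.isCompactOperator_toL2.smul (c : ℂ))

/-- The maximal operator `u ↦ -u'' + (V + c) u`, without boundary conditions. -/
def maxOp (c : ℝ) : X.Data →L[ℂ] X.L2 := X.potOp c - ContinuousLinearMap.fst ℂ _ _

theorem maxOp_ae_eq (c : ℝ) (p : X.Data) (e : E) : X.maxOp c p e =ᵐ[X.edgeMeasure e]
    fun x => -p.1 e x + ((X.potential e x : ℂ) + c) * (X.edge e p).fn x := by
  have happly : X.maxOp c p e =
      X.mulOp X.potential_ofReal_memLp p e + (c : ℂ) • X.toL2 p e - p.1 e := rfl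
  rw [happly]
  filter_upwards [X.toL2_ae_eq p e, X.mulOp_ae_eq X.potential_ofReal_memLp p e,
    Lp.coeFn_sub (X.mulOp X.potential_ofReal_memLp p e + (c : ℂ) • X.toL2 p e) (p.1 e),
    Lp.coeFn_add (X.mulOp X.potential_ofReal_memLp p e) ((c : ℂ) • X.toL2 p e),
    Lp.coeFn_smul (c : ℂ) (X.toL2 p e)] with x hfn hmul hsub hadd hsmul
  rw [hsub, Pi.sub_apply, hadd, Pi.add_apply, hsmul, Pi.smul_apply, hfn, hmul, smul_eq_mul]
  ring

theorem maxOp_eq_add (c : ℝ) (p : X.Data) : X.maxOp c p = X.maxOp 0 p + (c : ℂ) • X.toL2 p := by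
  simp only [maxOp, potOp, Complex.ofReal_zero, zero_smul, add_zero, sub_apply, add_apply,
    smul_apply]
  abel

/-- The sesquilinear form `∑ₑ ∫ (u' v̄' + (V + c) u v̄)`, linear in the first argument. -/
def form (c : ℝ) (p r : X.Data) : ℂ :=
  ∑ e, ∫ t in (0 : ℝ)..X.length e, ((X.edge e p).deriv t * conj ((X.edge e r).deriv t) +
    ((X.potential e t : ℂ) + c) * ((X.edge e p).fn t * conj ((X.edge e r).fn t)))

theorem inner_toL2 (r : X.Data) (g : X.L2) : ⟪X.toL2 r, g⟫_ℂ =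
    ∑ e, ∫ t in (0 : ℝ)..X.length e, g e t * conj ((X.edge e r).fn t) := by
  rw [PiLp.inner_apply]
  refine Finset.sum_congr rfl fun e _ => ?_
  rw [L2.inner_def, intervalIntegral.integral_of_le (X.length_pos e).le,
    ← integral_Icc_eq_integral_Ioc]
  refine integral_congr_ae ?_
  filter_upwards [X.toL2_ae_eq r e] with x hx
  rw [hx]
  exact RCLike.inner_apply _ _

theorem endDeriv_dotProduct_star_endValue (p r : X.Data) :
    X.endDeriv p ⬝ᵥ star (X.endValue r) = ∑ e, ((X.edge e p).deriv 0 * conj ((X.edge e r).fn 0) +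
      -(X.edge e p).deriv (X.length e) * conj ((X.edge e r).fn (X.length e))) := by
  rw [dotProduct, Fintype.sum_prod_type]
  refine Finset.sum_congr rfl fun e _ => ?_
  rw [Fintype.sum_bool, Pi.star_apply, Pi.star_apply, endValue_true, endValue_false,
    endDeriv_true, endDeriv_false, add_comm]
  rfl

theorem inner_maxOp (c : ℝ) (p r : X.Data) : ⟪X.toL2 r, X.maxOp c p⟫_ℂ =
    X.form c p r + X.endDeriv p ⬝ᵥ star (X.endValue r) := by
  rw [inner_toL2, form, endDeriv_dotProduct_star_endValue, ← Finset.sum_add_distrib]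
  refine Finset.sum_congr rfl fun e _ => ?_
  have hint : IntegrableOn (fun t => (X.potential e t : ℂ) + c) (Icc 0 (X.length e)) :=
    ((X.potential_ofReal_memLp e).add (memLp_const (c : ℂ))).integrable one_le_two
  rw [← (X.isSobolevH2 p e).green (X.length_pos e).le (X.isSobolevH2 r e) hint,
    intervalIntegral.integral_of_le (X.length_pos e).le,
    intervalIntegral.integral_of_le (X.length_pos e).le,
    ← integral_Icc_eq_integral_Ioc, ← integral_Icc_eq_integral_Ioc]
  refine integral_congr_ae ?_
  filter_upwards [X.maxOp_ae_eq c p e] with x hx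
  rw [hx]

theorem conj_form (c : ℝ) (p r : X.Data) : conj (X.form c p r) = X.form c r p := by
  rw [form, form, map_sum]
  refine Finset.sum_congr rfl fun e _ => ?_
  rw [intervalIntegral.integral_of_le (X.length_pos e).le,
    intervalIntegral.integral_of_le (X.length_pos e).le, ← integral_conj]
  refine integral_congr_ae (Filter.Eventually.of_forall fun t => ?_)
  simp only [map_add, map_mul, Complex.conj_conj, Complex.conj_ofReal]
  ring

theorem norm_toL2_sq (p : X.Data) :
    ‖X.toL2 p‖ ^ 2 = ∑ e, ∫ t in (0 : ℝ)..X.length e, ‖(X.edge e p).fn t‖ ^ 2 := by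
  apply Complex.ofReal_injective
  rw [Complex.ofReal_pow, ← Complex.coe_algebraMap, ← inner_self_eq_norm_sq_to_K (𝕜 := ℂ),
    inner_toL2, Complex.coe_algebraMap, Complex.ofReal_sum]
  refine Finset.sum_congr rfl fun e _ => ?_
  rw [← intervalIntegral.integral_ofReal, intervalIntegral.integral_of_le (X.length_pos e).le,
    intervalIntegral.integral_of_le (X.length_pos e).le, ← integral_Icc_eq_integral_Ioc,
    ← integral_Icc_eq_integral_Ioc]
  refine integral_congr_ae ?_
  filter_upwards [X.toL2_ae_eq p e] with x hx
  rw [hx, Complex.mul_conj', Complex.ofReal_pow]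

theorem re_form_self (c : ℝ) (p : X.Data) : (X.form c p p).re =
    ∑ e, ∫ t in (0 : ℝ)..X.length e,
      (‖(X.edge e p).deriv t‖ ^ 2 + (X.potential e t + c) * ‖(X.edge e p).fn t‖ ^ 2) := by
  rw [← Complex.ofReal_re (∑ e, _), Complex.ofReal_sum, form]
  congr! 3 with e
  rw [← intervalIntegral.integral_ofReal]
  refine intervalIntegral.integral_congr fun t _ => ?_
  simp only [Complex.mul_conj', Complex.ofReal_add, Complex.ofReal_mul, Complex.ofReal_pow]

theorem exists_form_bound {C : ℝ} (hC : 0 ≤ C) : ∃ c₀, ∀ c ≥ c₀, ∀ p : X.Data,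
    C * ∑ b, ‖X.endValue p b‖ ^ 2 + ‖X.toL2 p‖ ^ 2 ≤ (X.form c p p).re := by
  choose k hk using fun e => IsSobolevH2.exists_form_bound (X.length_pos e)
    ((X.potential_memLp e).integrable one_le_two) hC
  refine ⟨∑ e, |k e|, fun c hc p => ?_⟩
  rw [re_form_self, norm_toL2_sq, Fintype.sum_prod_type, Finset.mul_sum, ← Finset.sum_add_distrib]
  refine Finset.sum_le_sum fun e _ => ?_
  rw [Fintype.sum_bool, endValue_true, endValue_false, add_comm (‖_‖ ^ 2)]
  refine hk e c ?_ _ _ _ (X.isSobolevH2 p e)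
  calc k e ≤ |k e| := le_abs_self _
    _ ≤ ∑ e, |k e| := Finset.single_le_sum (f := fun e => |k e|) (fun i _ => abs_nonneg _)
      (Finset.mem_univ e)
    _ ≤ c := hc

end MetricEdges

end MetricEdges

/-! ### Lagrangian vertex conditions -/

section VertexCondition

open scoped Matrix

theorem exists_linearMap_forall_mk_mem {K E F : Type*} [DivisionRing K] [AddCommGroup E]
    [Module K E] [AddCommGroup F] [Module K F] (M : Submodule K (E × F)) :
    ∃ τ : E →ₗ[K] F, ∀ x ∈ M, (x.1, τ x.1) ∈ M := by
  let π : M →ₗ[K] E := (LinearMap.fst K E F).comp M.subtype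
  obtain ⟨s, hs⟩ := π.rangeRestrict.exists_rightInverse_of_surjective π.range_rangeRestrict
  obtain ⟨s', hs'⟩ := s.exists_extend
  refine ⟨(LinearMap.snd K E F).comp (M.subtype.comp s'), fun x hx => ?_⟩
  have hext : s' x.1 = s (π.rangeRestrict ⟨x, hx⟩) :=
    LinearMap.congr_fun hs' (π.rangeRestrict ⟨x, hx⟩)
  have hfst : (s' x.1 : E × F).1 = x.1 := by
    rw [hext]
    exact congrArg Subtype.val (LinearMap.congr_fun hs (π.rangeRestrict ⟨x, hx⟩))
  have hmk : (s' x.1 : E × F) = (x.1, (s' x.1 : E × F).2) := Prod.ext hfst rfl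
  exact hmk ▸ (s' x.1).2

theorem exists_norm_apply_dotProduct_star_le {𝕜 ι : Type*} [RCLike 𝕜] [Fintype ι]
    (τ : (ι → 𝕜) →ₗ[𝕜] (ι → 𝕜)) :
    ∃ C, 0 ≤ C ∧ ∀ F : ι → 𝕜, ‖τ F ⬝ᵥ star F‖ ≤ C * ∑ b, ‖F b‖ ^ 2 := by
  let τ' : EuclideanSpace 𝕜 ι →L[𝕜] EuclideanSpace 𝕜 ι := LinearMap.toContinuousLinearMap
    ((WithLp.linearEquiv 2 𝕜 (ι → 𝕜)).symm.toLinearMap ∘ₗ τ ∘ₗ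
      (WithLp.linearEquiv 2 𝕜 (ι → 𝕜)).toLinearMap)
  refine ⟨‖τ'‖, norm_nonneg _, fun F => ?_⟩
  let x : EuclideanSpace 𝕜 ι := WithLp.toLp 2 F
  calc ‖τ F ⬝ᵥ star F‖ = ‖inner 𝕜 x (τ' x)‖ := rfl
    _ ≤ ‖x‖ * (‖τ'‖ * ‖x‖) := (norm_inner_le_norm _ _).trans
      (mul_le_mul_of_nonneg_left (τ'.le_opNorm x) (norm_nonneg x))
    _ = ‖τ'‖ * ∑ b, ‖F b‖ ^ 2 := by
      rw [← EuclideanSpace.norm_sq_eq x]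
      ring

namespace VertexCondition

variable {ι κ : Type*} [Fintype ι] [Fintype κ] {M : VertexCondition ι}

/-- A vertex condition is isotropic if the boundary terms of Green's formula cancel on it. -/
def IsIsotropic (M : VertexCondition ι) : Prop :=
  ∀ x ∈ M, ∀ y ∈ M, x.2 ⬝ᵥ star y.1 = x.1 ⬝ᵥ star y.2

theorem IsIsotropic.dotProduct_star_eq_star (hM : M.IsIsotropic) {x y : (ι → ℂ) × (ι → ℂ)}
    (hx : x ∈ M) (hy : y ∈ M) : x.2 ⬝ᵥ star y.1 = star (y.2 ⬝ᵥ star x.1) := by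
  rw [hM x hx y hy, Matrix.dotProduct_star]

theorem IsIsotropic.exists_norm_dotProduct_star_le (hM : M.IsIsotropic) :
    ∃ C, 0 ≤ C ∧ ∀ x ∈ M, ‖x.2 ⬝ᵥ star x.1‖ ≤ C * ∑ b, ‖x.1 b‖ ^ 2 := by
  obtain ⟨τ, hτ⟩ := exists_linearMap_forall_mk_mem M
  obtain ⟨C, hC, hbound⟩ := exists_norm_apply_dotProduct_star_le τ
  refine ⟨C, hC, fun x hx => ?_⟩
  have heq : τ x.1 ⬝ᵥ star x.1 = x.2 ⬝ᵥ star x.1 :=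
    (hM _ (hτ x hx) x hx).trans (hM x hx x hx).symm
  exact heq ▸ hbound x.1

/-- A vertex condition is Lagrangian if it is isotropic and of maximal dimension; the latter is
expressed by its being cut out by as many linear equations as there are edge ends. -/
structure IsLagrangian (M : VertexCondition ι) : Prop where
  isIsotropic : M.IsIsotropic
  exists_eq_ker : ∃ T : (ι → ℂ) × (ι → ℂ) →ₗ[ℂ] (ι → ℂ), M = LinearMap.ker T

theorem mem_transport {ι κ : Type*} {M : VertexCondition ι} {i : ι → κ}
    {x : (κ → ℂ) × (κ → ℂ)} : x ∈ M.transport i ↔ (x.1 ∘ i, x.2 ∘ i) ∈ M := Iff.rfl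

theorem IsLagrangian.transport (hM : M.IsLagrangian) {i : ι → κ} (hi : Function.Bijective i) :
    (M.transport i).IsLagrangian where
  isIsotropic x hx y hy := by
    rw [dotProduct, dotProduct, ← hi.sum_comp, ← hi.sum_comp]
    exact hM.isIsotropic _ (mem_transport.1 hx) _ (mem_transport.1 hy)
  exists_eq_ker := by
    obtain ⟨T, hT⟩ := hM.exists_eq_ker
    let e := Equiv.ofBijective i hi
    refine ⟨(LinearMap.funLeft ℂ ℂ e.symm).comp (T.comp
      ((LinearMap.funLeft ℂ ℂ i).prodMap (LinearMap.funLeft ℂ ℂ i))), ?_⟩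
    rw [LinearMap.ker_comp_of_ker_eq_bot, LinearMap.ker_comp, ← hT, VertexCondition.transport]
    exact LinearMap.ker_eq_bot.2 (LinearMap.funLeft_injective_of_surjective ℂ ℂ _ e.symm.surjective)

theorem mem_delta {α : ℝ} {x : (ι → ℂ) × (ι → ℂ)} : x ∈ delta ι α ↔
    (∀ b c, x.1 b = x.1 c) ∧ ∀ b, ∑ c, x.2 c = (α : ℂ) * x.1 b := Iff.rfl

theorem mem_delta_iff (o : ι) {α : ℝ} {x : (ι → ℂ) × (ι → ℂ)} : x ∈ delta ι α ↔
    (∀ b, x.1 b = x.1 o) ∧ ∑ c, x.2 c = (α : ℂ) * x.1 o where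
  mp h := ⟨fun b => h.1 b o, h.2 o⟩
  mpr h := ⟨fun b c => (h.1 b).trans (h.1 c).symm, fun b => by rw [h.2, h.1 b]⟩

theorem dotProduct_star_of_mem_delta {α : ℝ} {x y : (ι → ℂ) × (ι → ℂ)} (hx : x ∈ delta ι α)
    (hy : y ∈ delta ι α) (b : ι) : x.2 ⬝ᵥ star y.1 = α * (x.1 b * star (y.1 b)) := by
  rw [← mul_assoc, ← (mem_delta.1 hx).2 b, Finset.sum_mul]
  exact Finset.sum_congr rfl fun c _ => by rw [Pi.star_apply, (mem_delta.1 hy).1 c b]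

theorem isIsotropic_delta (α : ℝ) : (delta ι α).IsIsotropic := by
  intro x hx y hy
  rcases isEmpty_or_nonempty ι with _ | ⟨⟨b⟩⟩
  · rw [Subsingleton.elim x.2 x.1, Subsingleton.elim y.1 y.2]
  · rw [Matrix.dotProduct_star x.1, dotProduct_star_of_mem_delta hx hy b,
      dotProduct_star_of_mem_delta hy hx b, Complex.star_def, map_mul, map_mul, Complex.conj_ofReal,
      Complex.conj_conj, mul_comm (x.1 b)]

/-- The equations of the δ-type condition, with the edge end `o` as reference. -/
def deltaEquations [DecidableEq ι] (o : ι) (α : ℝ) : (ι → ℂ) × (ι → ℂ) →ₗ[ℂ] (ι → ℂ) where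
  toFun x b := if b = o then ∑ c, x.2 c - α * x.1 o else x.1 b - x.1 o
  map_add' x y := by
    ext b
    simp only [Prod.fst_add, Prod.snd_add, Pi.add_apply, Finset.sum_add_distrib]
    split_ifs <;> ring
  map_smul' z x := by
    ext b
    simp only [Prod.smul_fst, Prod.smul_snd, Pi.smul_apply, smul_eq_mul, ← Finset.mul_sum,
      RingHom.id_apply]
    split_ifs <;> ring

theorem delta_eq_ker_deltaEquations [DecidableEq ι] (o : ι) (α : ℝ) :
    delta ι α = LinearMap.ker (deltaEquations o α) := by
  ext x
  rw [mem_delta_iff o, LinearMap.mem_ker, funext_iff]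
  refine ⟨fun ⟨hcont, hsum⟩ b => ?_, fun h => ⟨fun b => ?_, ?_⟩⟩
  · change ite _ _ _ = (0 : ℂ)
    rw [hsum, hcont b, sub_self, sub_self, ite_self]
  · by_cases hb : b = o
    · rw [hb]
    · exact sub_eq_zero.1 ((if_neg hb).symm.trans (h b))
  · exact sub_eq_zero.1 ((if_pos rfl).symm.trans (h o))

theorem isLagrangian_delta [Nonempty ι] (α : ℝ) : (delta ι α).IsLagrangian := by
  classical
  exact ⟨isIsotropic_delta α, _, delta_eq_ker_deltaEquations (Classical.arbitrary ι) α⟩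

end VertexCondition

section SelfAdjoint

variable {ι 𝕜 : Type*} [Fintype ι] [RCLike 𝕜] {A B : Matrix ι ι 𝕜}

theorem range_coprod_mulVecLin_eq_top (h : (Matrix.fromCols A B).rank = Fintype.card ι) :
    LinearMap.range (A.mulVecLin.coprod B.mulVecLin) = ⊤ := by
  have htop : LinearMap.range (Matrix.fromCols A B).mulVecLin = ⊤ :=
    Submodule.eq_top_of_finrank_eq (h.trans (Module.finrank_fintype_fun_eq_card 𝕜).symm)
  rw [LinearMap.range_eq_top] at htop ⊢
  intro y
  obtain ⟨v, hv⟩ := htop y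
  exact ⟨(v ∘ Sum.inl, v ∘ Sum.inr), (Matrix.fromCols_mulVec A B v).symm.trans hv⟩

open scoped ComplexOrder in
theorem ker_prod_conjTranspose_mulVecLin_eq_bot
    (h : LinearMap.range (A.mulVecLin.coprod B.mulVecLin) = ⊤) :
    LinearMap.ker (Bᴴ.mulVecLin.prod (-Aᴴ.mulVecLin)) = ⊥ := by
  refine LinearMap.ker_eq_bot'.2 fun x hx => ?_
  obtain ⟨hB, hA⟩ := Prod.mk_eq_zero.1 hx
  obtain ⟨⟨u, v⟩, huv⟩ := LinearMap.range_eq_top.1 h x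
  have hA' : star x ᵥ* A = 0 := by
    rw [← star_eq_zero, Matrix.star_vecMul, star_star]
    exact neg_eq_zero.1 hA
  have hB' : star x ᵥ* B = 0 := by
    rw [← star_eq_zero, Matrix.star_vecMul, star_star]
    exact hB
  refine dotProduct_star_self_eq_zero.1 ?_
  calc star x ⬝ᵥ x = star x ⬝ᵥ (A *ᵥ u + B *ᵥ v) := congrArg _ huv.symm
    _ = 0 := by
      rw [dotProduct_add, Matrix.dotProduct_mulVec, Matrix.dotProduct_mulVec, hA', hB',
        zero_dotProduct, zero_dotProduct, add_zero]

theorem range_prod_eq_ker_coprod (hrank : (Matrix.fromCols A B).rank = Fintype.card ι)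
    (hsymm : B * Aᴴ = A * Bᴴ) : LinearMap.range (Bᴴ.mulVecLin.prod (-Aᴴ.mulVecLin)) =
      LinearMap.ker (A.mulVecLin.coprod B.mulVecLin) := by
  have hrange := range_coprod_mulVecLin_eq_top hrank
  refine Submodule.eq_of_le_of_finrank_eq ?_ ?_
  · rintro _ ⟨x, rfl⟩
    change A *ᵥ (Bᴴ *ᵥ x) + B *ᵥ (-(Aᴴ *ᵥ x)) = 0
    rw [Matrix.mulVec_neg, Matrix.mulVec_mulVec, Matrix.mulVec_mulVec, hsymm, add_neg_cancel]
  · have hprod := (Bᴴ.mulVecLin.prod (-Aᴴ.mulVecLin)).finrank_range_add_finrank_ker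
    have hcoprod := (A.mulVecLin.coprod B.mulVecLin).finrank_range_add_finrank_ker
    rw [ker_prod_conjTranspose_mulVecLin_eq_bot hrange, finrank_bot] at hprod
    rw [hrange, finrank_top, Module.finrank_prod] at hcoprod
    omega

theorem conjTranspose_mulVec_dotProduct_star (P Q : Matrix ι ι 𝕜) (a b : ι → 𝕜) :
    (Pᴴ *ᵥ a) ⬝ᵥ star (Qᴴ *ᵥ b) = star b ⬝ᵥ (Q * Pᴴ) *ᵥ a := by
  rw [Matrix.star_mulVec, Matrix.conjTranspose_conjTranspose, dotProduct_comm,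
    ← Matrix.dotProduct_mulVec, Matrix.mulVec_mulVec]

theorem VertexCondition.IsSelfAdjoint.isLagrangian {M : VertexCondition ι}
    (hM : M.IsSelfAdjoint) : M.IsLagrangian := by
  obtain ⟨A, B, hrank, hherm, hmem⟩ := hM
  have hsymm : B * Aᴴ = A * Bᴴ := by
    rw [← hherm.eq, Matrix.conjTranspose_mul, Matrix.conjTranspose_conjTranspose]
  have hker : M = LinearMap.ker (A.mulVecLin.coprod B.mulVecLin) :=
    Submodule.ext fun x => hmem x.1 x.2
  refine ⟨fun x hx y hy => ?_, _, hker⟩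
  rw [hker, ← range_prod_eq_ker_coprod hrank hsymm] at hx hy
  obtain ⟨a, rfl⟩ := hx
  obtain ⟨b, rfl⟩ := hy
  change (-(Aᴴ *ᵥ a)) ⬝ᵥ star (Bᴴ *ᵥ b) = (Bᴴ *ᵥ a) ⬝ᵥ star (-(Aᴴ *ᵥ b))
  rw [star_neg, neg_dotProduct, dotProduct_neg, conjTranspose_mulVec_dotProduct_star,
    conjTranspose_mulVec_dotProduct_star, hsymm]

end SelfAdjoint

end VertexCondition

/-! ### Boundary value problems -/

noncomputable section BoundaryValueProblem

open scoped ComplexConjugate InnerProductSpace Matrix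

theorem isCompactOperator_prod {M N P : Type*} [TopologicalSpace M] [Zero M] [TopologicalSpace N]
    [TopologicalSpace P] {f : M → N} {g : M → P} (hf : IsCompactOperator f)
    (hg : IsCompactOperator g) : IsCompactOperator fun x => (f x, g x) := by
  obtain ⟨K, hK, hfK⟩ := hf
  obtain ⟨L, hL, hgL⟩ := hg
  exact ⟨K ×ˢ L, hK.prod hL, Filter.inter_mem hfK hgL⟩

theorem isUnit_one_sub_of_isCompactOperator {𝕜 Z : Type*} [NontriviallyNormedField 𝕜]
    [NormedAddCommGroup Z] [NormedSpace 𝕜 Z] [CompleteSpace Z] {K : Z →L[𝕜] Z}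
    (hK : IsCompactOperator K) (h : ∀ x, K x = x → x = 0) : IsUnit (1 - K) := by
  have hone : ¬ Module.End.HasEigenvalue (K : Z →ₗ[𝕜] Z) 1 := fun heig => by
    obtain ⟨x, hx, hx0⟩ := heig.exists_hasEigenvector
    exact hx0 (h x ((Module.End.mem_eigenspace_iff.1 hx).trans (one_smul 𝕜 x)))
  have hmem := (hK.hasEigenvalue_or_mem_resolventSet one_ne_zero).resolve_left hone
  rwa [spectrum.mem_resolventSet_iff, map_one] at hmem

namespace MetricEdges

variable {E : Type*} [Fintype E] (X : MetricEdges E)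

/-- The quadratic form of `-d²/dx² + V + c`; the vector `F'` of derivatives that enters the vertex
terms need not be `endDeriv r`, since the form domain only restricts the vertex values. -/
def energy (c : ℝ) (r : X.Data) (F' : E × Bool → ℂ) : ℝ :=
  (X.form c r r + F' ⬝ᵥ star (X.endValue r)).re

theorem energy_endDeriv (c : ℝ) (p : X.Data) :
    X.energy c p (X.endDeriv p) = (⟪X.toL2 p, X.maxOp c p⟫_ℂ).re := by
  rw [energy, inner_maxOp]

theorem form_sub_sub (c : ℝ) (p r : X.Data) : X.form c (p - r) (p - r) =
    X.form c p p - X.form c p r - X.form c r p + X.form c r r := by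
  have hform : ∀ p r, X.form c p r =
      ⟪X.toL2 r, X.maxOp c p⟫_ℂ - X.endDeriv p ⬝ᵥ star (X.endValue r) := fun p r =>
    eq_sub_of_add_eq (X.inner_maxOp c p r).symm
  simp only [hform, map_sub, inner_sub_left, inner_sub_right, star_sub, sub_dotProduct,
    dotProduct_sub]
  ring

/-- On the form domain of the vertex condition `M`, the operator shifted by `c` is at least `1`. -/
def IsPositiveShift (M : VertexCondition (E × Bool)) (c : ℝ) : Prop :=
  ∀ p F', (X.endValue p, F') ∈ M → ‖X.toL2 p‖ ^ 2 ≤ X.energy c p F'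

theorem exists_isPositiveShift {M : VertexCondition (E × Bool)} (hM : M.IsIsotropic) :
    ∃ c₀, ∀ c ≥ c₀, X.IsPositiveShift M c := by
  obtain ⟨C, hC, hvertex⟩ := hM.exists_norm_dotProduct_star_le
  obtain ⟨c₀, hform⟩ := X.exists_form_bound hC
  refine ⟨c₀, fun c hc p F' hF => ?_⟩
  have hre := (abs_le.1 ((Complex.abs_re_le_norm _).trans (hvertex _ hF))).1
  rw [energy, Complex.add_re]
  linarith [hform c hc p]

/-- `S` solves the boundary value problem `-u'' + (V + c) u = g` with boundary condition `M`. -/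
structure IsSolutionOperator (M : VertexCondition (E × Bool)) (c : ℝ) (S : X.L2 →L[ℂ] X.Data) :
    Prop where
  trace_mem : ∀ g, X.trace (S g) ∈ M
  maxOp_apply : ∀ g, X.maxOp c (S g) = g
  apply_maxOp : ∀ p, X.trace p ∈ M → S (X.maxOp c p) = p

variable {X} {M M' : VertexCondition (E × Bool)} {c : ℝ} {S S' : X.L2 →L[ℂ] X.Data}

theorem IsPositiveShift.eq_zero_of_maxOp_eq_zero (hc : X.IsPositiveShift M c) {p : X.Data}
    (hp : X.trace p ∈ M) (hzero : X.maxOp c p = 0) : p = 0 := by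
  have hnorm := hc p (X.endDeriv p) hp
  rw [energy_endDeriv, hzero, inner_zero_right, Complex.zero_re] at hnorm
  have htoL2 : X.toL2 p = 0 :=
    norm_eq_zero.1 (pow_eq_zero_iff two_ne_zero |>.1 (le_antisymm hnorm (sq_nonneg _)))
  exact X.toL2_injective (htoL2.trans (map_zero X.toL2).symm)

theorem IsPositiveShift.exists_continuousLinearEquiv
    {T : (E × Bool → ℂ) × (E × Bool → ℂ) →ₗ[ℂ] (E × Bool → ℂ)}
    (hc : X.IsPositiveShift (LinearMap.ker T) c) :
    ∃ Φ : X.Data ≃L[ℂ] X.Data, ∀ p, Φ p = (-X.maxOp c p, T (X.trace p)) := by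
  let B : X.Data →L[ℂ] (E × Bool → ℂ) := (LinearMap.toContinuousLinearMap T).comp X.trace
  -- `(u'', b) ↦ (u'' - (V + c) u, T (trace u))` is a compact perturbation of the identity.
  let K : X.Data →L[ℂ] X.Data := (X.potOp c).prod (ContinuousLinearMap.snd ℂ _ _ - B)
  have hK : IsCompactOperator K := isCompactOperator_prod (X.isCompactOperator_potOp c)
    (isCompactOperator_of_locallyCompactSpace_dom (ContinuousLinearMap.snd ℂ X.L2 _ - B))
  have hsub : ∀ p, (1 - K) p = (-X.maxOp c p, T (X.trace p)) := fun p =>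
    Prod.ext (neg_sub (X.potOp c p) p.1).symm (sub_sub_cancel p.2 (B p))
  have hinj : ∀ p, K p = p → p = 0 := fun p hp => by
    have hzero := hsub p
    rw [sub_apply, hp, one_apply_eq_self, sub_self, eq_comm, Prod.mk_eq_zero,
      neg_eq_zero] at hzero
    exact hc.eq_zero_of_maxOp_eq_zero hzero.2 hzero.1
  exact ⟨ContinuousLinearEquiv.unitsEquiv ℂ X.Data
      (isUnit_one_sub_of_isCompactOperator hK hinj).unit,
    hsub⟩

theorem IsPositiveShift.exists_isSolutionOperator (hc : X.IsPositiveShift M c)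
    (hM : M.IsLagrangian) : ∃ S, X.IsSolutionOperator M c S := by
  obtain ⟨-, T, rfl⟩ := hM
  obtain ⟨Φ, hΦ⟩ := hc.exists_continuousLinearEquiv
  let S : X.L2 →L[ℂ] X.Data :=
    (Φ.symm : X.Data →L[ℂ] X.Data).comp ((-ContinuousLinearMap.id ℂ X.L2).prod 0)
  have hS : ∀ g, (-X.maxOp c (S g), T (X.trace (S g))) = (-g, 0) := fun g =>
    (hΦ (S g)).symm.trans (Φ.apply_symm_apply (-g, 0))
  refine ⟨S, fun g => congrArg Prod.snd (hS g), fun g => neg_injective (congrArg Prod.fst (hS g)),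
    fun p hp => Φ.symm_apply_eq.2 ?_⟩
  rw [hΦ, LinearMap.mem_ker.1 hp]
  rfl

variable (X) in
/-- The Hamiltonian `-d²/dx² + V` with vertex condition `M` imposed on all the ends at once. -/
def hamiltonian (M : VertexCondition (E × Bool)) : LinearRelation X.L2 :=
  (M.comap X.trace.toLinearMap).map (X.toL2.prod (X.maxOp 0)).toLinearMap

theorem mem_hamiltonian {f g : X.L2} : (f, g) ∈ X.hamiltonian M ↔
    ∃ p, X.trace p ∈ M ∧ X.toL2 p = f ∧ X.maxOp 0 p = g := by
  simp only [hamiltonian, Submodule.mem_map, Submodule.mem_comap, ContinuousLinearMap.coe_coe,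
    ContinuousLinearMap.prod_apply, Prod.mk.injEq]

theorem IsSolutionOperator.mem_hamiltonian_iff (hS : X.IsSolutionOperator M c S) (f g : X.L2) :
    (f, g) ∈ X.hamiltonian M ↔ X.toL2 (S (g + (c : ℂ) • f)) = f := by
  rw [mem_hamiltonian]
  constructor
  · rintro ⟨p, hp, rfl, rfl⟩
    rw [← maxOp_eq_add, hS.apply_maxOp p hp]
  · intro hf
    have hmax := X.maxOp_eq_add c (S (g + (c : ℂ) • f))
    rw [hS.maxOp_apply, hf, add_left_inj] at hmax
    exact ⟨_, hS.trace_mem _, hf, hmax.symm⟩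

theorem IsSolutionOperator.isPositiveResolvent (hS : X.IsSolutionOperator M c S)
    (hM : M.IsIsotropic) (hc : X.IsPositiveShift M c) :
    LinearRelation.IsPositiveResolvent (X.hamiltonian M) c (X.toL2.comp S) where
  mem_iff := hS.mem_hamiltonian_iff
  isCompact := X.isCompactOperator_toL2.comp_clm S
  isPositive := by
    refine ⟨fun g h => ?_, fun g => ?_⟩
    · change ⟪X.toL2 (S g), h⟫_ℂ = ⟪g, X.toL2 (S h)⟫_ℂ
      rw [← inner_conj_symm g]
      nth_rw 1 [← hS.maxOp_apply h]
      nth_rw 2 [← hS.maxOp_apply g]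
      rw [inner_maxOp, inner_maxOp, map_add, conj_form]
      exact congrArg _ (hM.dotProduct_star_eq_star (hS.trace_mem h) (hS.trace_mem g))
    · have hpos := (sq_nonneg _).trans (hc (S g) (X.endDeriv (S g)) (hS.trace_mem g))
      rwa [energy_endDeriv, hS.maxOp_apply] at hpos
  injective g h heq :=
    (hS.maxOp_apply g).symm.trans
      ((congrArg (X.maxOp c) (X.toL2_injective heq)).trans (hS.maxOp_apply h))

theorem energy_sub (hM : M.IsIsotropic) {p r : X.Data} {F' : E × Bool → ℂ}
    (hp : X.trace p ∈ M) (hr : (X.endValue r, F') ∈ M) :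
    X.energy c (p - r) (X.endDeriv p - F') = (⟪X.toL2 p, X.maxOp c p⟫_ℂ).re -
      2 * (⟪X.toL2 r, X.maxOp c p⟫_ℂ).re + X.energy c r F' := by
  have hcross : F' ⬝ᵥ star (X.endValue p) = star (X.endDeriv p ⬝ᵥ star (X.endValue r)) :=
    hM.dotProduct_star_eq_star hr hp
  rw [energy, energy, form_sub_sub, inner_maxOp, inner_maxOp, map_sub, star_sub, sub_dotProduct,
    dotProduct_sub, dotProduct_sub, hcross, ← X.conj_form c p r, Complex.star_def]
  simp only [Complex.add_re, Complex.sub_re, Complex.conj_re]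
  ring

/-- Together with the case of equality `r = S g`, this characterises the quadratic form of the
resolvent by a maximum over the form domain. -/
theorem IsSolutionOperator.sub_energy_le (hS : X.IsSolutionOperator M c S) (hM : M.IsIsotropic)
    (hc : X.IsPositiveShift M c) (g : X.L2) {r : X.Data} {F' : E × Bool → ℂ}
    (hr : (X.endValue r, F') ∈ M) :
    2 * (⟪X.toL2 r, g⟫_ℂ).re - X.energy c r F' ≤ (⟪X.toL2 (S g), g⟫_ℂ).re := by
  have hmem : (X.endValue (S g - r), X.endDeriv (S g) - F') ∈ M := by
    rw [map_sub]
    exact M.sub_mem (hS.trace_mem g) hr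
  have hpos := (sq_nonneg _).trans (hc _ _ hmem)
  rw [energy_sub hM (hS.trace_mem g) hr, hS.maxOp_apply] at hpos
  linarith

theorem IsSolutionOperator.re_inner_le (hS : X.IsSolutionOperator M c S)
    (hS' : X.IsSolutionOperator M' c S') (hM : M.IsIsotropic) (hc : X.IsPositiveShift M c)
    (hle : ∀ x ∈ M', ∃ F', (x.1, F') ∈ M ∧ F' ⬝ᵥ star x.1 = x.2 ⬝ᵥ star x.1) (g : X.L2) :
    (⟪X.toL2 (S' g), g⟫_ℂ).re ≤ (⟪X.toL2 (S g), g⟫_ℂ).re := by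
  obtain ⟨F', hF, hdot⟩ := hle (X.trace (S' g)) (hS'.trace_mem g)
  have henergy : X.energy c (S' g) F' = (⟪X.toL2 (S' g), g⟫_ℂ).re :=
    calc X.energy c (S' g) F' = X.energy c (S' g) (X.endDeriv (S' g)) :=
          congrArg (fun z => (X.form c (S' g) (S' g) + z).re) hdot
      _ = (⟪X.toL2 (S' g), g⟫_ℂ).re := by rw [energy_endDeriv, hS'.maxOp_apply]
  linarith [hS.sub_energy_le hM hc g hF]

theorem IsSolutionOperator.eq_of_trace_mem (hS : X.IsSolutionOperator M c S)
    (hS' : X.IsSolutionOperator M' c S') {g : X.L2} (h : X.trace (S g) ∈ M') : S g = S' g := by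
  rw [← hS'.apply_maxOp (S g) h, hS.maxOp_apply]

variable (X) in
theorem exists_isEigenvalueSequence [Nonempty E] (hM : M.IsLagrangian) :
    ∃ l, (X.hamiltonian M).IsEigenvalueSequence l := by
  obtain ⟨c, hc⟩ := X.exists_isPositiveShift hM.isIsotropic
  obtain ⟨S, hS⟩ := (hc c le_rfl).exists_isSolutionOperator hM
  exact (hS.isPositiveResolvent hM.isIsotropic (hc c le_rfl)).exists_isEigenvalueSequence
    X.not_finiteDimensional_L2

theorem exists_isSolutionOperator_pair (X : MetricEdges E) (hM : M.IsLagrangian)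
    (hM' : M'.IsLagrangian) : ∃ c, X.IsPositiveShift M c ∧ X.IsPositiveShift M' c ∧
      (∃ S, X.IsSolutionOperator M c S) ∧ ∃ S', X.IsSolutionOperator M' c S' := by
  obtain ⟨c, hc⟩ := X.exists_isPositiveShift hM.isIsotropic
  obtain ⟨c', hc'⟩ := X.exists_isPositiveShift hM'.isIsotropic
  have hmax := hc _ (le_max_left c c')
  have hmax' := hc' _ (le_max_right c c')
  exact ⟨_, hmax, hmax', hmax.exists_isSolutionOperator hM, hmax'.exists_isSolutionOperator hM'⟩

variable {l l' : ℕ → ℝ}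

/-- The hypothesis `hle` says that `M'` has the smaller form domain, with the same form on it. -/
theorem eigenvalue_mono (hM : M.IsLagrangian) (hM' : M'.IsLagrangian)
    (hle : ∀ x ∈ M', ∃ F', (x.1, F') ∈ M ∧ F' ⬝ᵥ star x.1 = x.2 ⬝ᵥ star x.1)
    (hl : (X.hamiltonian M).IsEigenvalueSequence l)
    (hl' : (X.hamiltonian M').IsEigenvalueSequence l') (n : ℕ) : l n ≤ l' n := by
  obtain ⟨c, hc, hc', ⟨S, hS⟩, S', hS'⟩ := X.exists_isSolutionOperator_pair hM hM'
  have hcompare := (hS.isPositiveResolvent hM.isIsotropic hc).eigenvalue_le_add_finrank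
    (hS'.isPositiveResolvent hM'.isIsotropic hc') (0 : X.L2 →ₗ[ℂ] PUnit)
    (fun g _ => hS.re_inner_le hS' hM.isIsotropic hc hle g) hl hl' n
  rwa [Module.finrank_zero_of_subsingleton, add_zero] at hcompare

theorem eigenvalue_le_add_finrank (hM : M.IsLagrangian) (hM' : M'.IsLagrangian) {W : Type*}
    [AddCommGroup W] [Module ℂ W] [FiniteDimensional ℂ W]
    (ψ : (E × Bool → ℂ) × (E × Bool → ℂ) →ₗ[ℂ] W) (hψ : ∀ x ∈ M, ψ x = 0 → x ∈ M')
    (hl : (X.hamiltonian M).IsEigenvalueSequence l)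
    (hl' : (X.hamiltonian M').IsEigenvalueSequence l') (n : ℕ) :
    l' n ≤ l (n + Module.finrank ℂ W) := by
  obtain ⟨c, hc, hc', ⟨S, hS⟩, S', hS'⟩ := X.exists_isSolutionOperator_pair hM hM'
  refine (hS'.isPositiveResolvent hM'.isIsotropic hc').eigenvalue_le_add_finrank
    (hS.isPositiveResolvent hM.isIsotropic hc) (ψ ∘ₗ (X.trace.comp S).toLinearMap)
    (fun g hg => ?_) hl' hl n
  have heq : S g = S' g := hS.eq_of_trace_mem hS' (hψ _ (hS.trace_mem g) hg)
  exact (congrArg (fun p => (⟪X.toL2 p, g⟫_ℂ).re) heq).le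

end MetricEdges

end BoundaryValueProblem

/-! ### The Hamiltonian of a quantum graph -/

noncomputable section QuantumGraph

open Set

open scoped Matrix

namespace IntervalData

variable {L : ℝ} {u u' u'' : ℝ → ℂ} {p : IntervalData L}

theorem eqOn_deriv (h : IsSobolevH2 L u u' u'') (hp : p.1 =ᵐ[volume.restrict (Icc 0 L)] u'')
    (hp0 : p.2.2 = u' 0) : EqOn p.deriv u' (Icc 0 L) := fun x hx => by
  rw [deriv, h.deriv_eq x hx, hp0, intervalIntegral.integral_of_le hx.1,
    intervalIntegral.integral_of_le hx.1]
  exact congrArg _ (integral_congr_ae (ae_mono (Measure.restrict_mono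
    (Ioc_subset_Icc_self.trans (Icc_subset_Icc_right hx.2)) le_rfl) hp))

theorem eqOn_fn (h : IsSobolevH2 L u u' u'') (hp : EqOn p.deriv u' (Icc 0 L))
    (hp0 : p.2.1 = u 0) : EqOn p.fn u (Icc 0 L) := fun x hx => by
  rw [fn, h.eq x hx, hp0]
  refine congrArg _ (intervalIntegral.integral_congr fun t ht => hp ?_)
  rw [uIcc_of_le hx.1] at ht
  exact ⟨ht.1, ht.2.trans hx.2⟩

end IntervalData

theorem MetricEdges.exists_data {E : Type*} (X : MetricEdges E) {u u' u'' : E → ℝ → ℂ}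
    (hu : ∀ e, IsSobolevH2 (X.length e) (u e) (u' e) (u'' e)) :
    ∃ p : X.Data, ∀ e, p.1 e =ᵐ[X.edgeMeasure e] u'' e ∧
      EqOn (X.edge e p).deriv (u' e) (Icc 0 (X.length e)) ∧
      EqOn (X.edge e p).fn (u e) (Icc 0 (X.length e)) := by
  let p : X.Data := (WithLp.toLp 2 fun e => (hu e).memLp.toLp (u'' e),
    fun b => if b.2 then u' b.1 0 else u b.1 0)
  have hderiv : ∀ e, EqOn (X.edge e p).deriv (u' e) (Icc 0 (X.length e)) := fun e =>
    IntervalData.eqOn_deriv (hu e) (hu e).memLp.coeFn_toLp rfl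
  exact ⟨p, fun e => ⟨(hu e).memLp.coeFn_toLp, hderiv e,
    IntervalData.eqOn_fn (hu e) (hderiv e) rfl⟩⟩

namespace QuantumGraph

variable {V E : Type*} {Γ : QuantumGraph V E}

/-- The quantum graph with its vertices removed. -/
abbrev toMetricEdges (Γ : QuantumGraph V E) : MetricEdges E where
  length := Γ.length
  length_pos := Γ.length_pos
  potential := Γ.potential
  potential_memLp := Γ.potential_memLp

theorem endValue_toMetricEdges {p : Γ.toMetricEdges.Data} {u : E → ℝ → ℂ}
    (h : ∀ e, EqOn (Γ.toMetricEdges.edge e p).fn (u e) (Icc 0 (Γ.length e))) :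
    Γ.toMetricEdges.endValue p = Γ.endValue u := by
  ext ⟨e, _ | _⟩
  · exact h e (left_mem_Icc.2 (Γ.length_pos e).le)
  · exact h e (right_mem_Icc.2 (Γ.length_pos e).le)

theorem endDeriv_toMetricEdges {p : Γ.toMetricEdges.Data} {u' : E → ℝ → ℂ}
    (h : ∀ e, EqOn (Γ.toMetricEdges.edge e p).deriv (u' e) (Icc 0 (Γ.length e))) :
    Γ.toMetricEdges.endDeriv p = Γ.endDeriv u' := by
  ext ⟨e, _ | _⟩
  · exact (Γ.toMetricEdges.endDeriv_false p e).trans (h e (left_mem_Icc.2 (Γ.length_pos e).le))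
  · exact (Γ.toMetricEdges.endDeriv_true p e).trans
      (congrArg Neg.neg (h e (right_mem_Icc.2 (Γ.length_pos e).le)))

/-- All the vertex conditions of a quantum graph, as one condition on all its edge ends. -/
def boundary (Γ : QuantumGraph V E) : VertexCondition (E × Bool) :=
  ⨅ v, (Γ.cond v).transport Subtype.val

theorem mem_boundary {x : (E × Bool → ℂ) × (E × Bool → ℂ)} : x ∈ Γ.boundary ↔
    ∀ v, ((fun b : Γ.EndsAt v => x.1 b), fun b : Γ.EndsAt v => x.2 b) ∈ Γ.cond v :=
  Submodule.mem_iInf _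

variable [Fintype E]

theorem hamiltonian_eq (Γ : QuantumGraph V E) :
    Γ.hamiltonian = Γ.toMetricEdges.hamiltonian Γ.boundary := by
  ext ⟨f, g⟩
  rw [MetricEdges.mem_hamiltonian]
  set X := Γ.toMetricEdges
  constructor
  · rintro ⟨u, u', u'', hu, hf, hg, hv⟩
    obtain ⟨p, hp⟩ := X.exists_data hu
    refine ⟨p, mem_boundary.2 fun v => ?_, PiLp.ext fun e => Lp.ext ?_, PiLp.ext fun e => Lp.ext ?_⟩
    · rw [MetricEdges.trace, ContinuousLinearMap.prod_apply,
        endValue_toMetricEdges fun e => (hp e).2.2, endDeriv_toMetricEdges fun e => (hp e).2.1]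
      exact hv v
    · filter_upwards [X.toL2_ae_eq p e, hf e, ae_restrict_mem measurableSet_Icc]
        with x hpx hfx hx
      rw [hpx, hfx, (hp e).2.2 hx]
    · filter_upwards [X.maxOp_ae_eq 0 p e, hg e, ae_restrict_mem measurableSet_Icc, (hp e).1]
        with x hpx hgx hx hx''
      rw [hpx, hgx, (hp e).2.2 hx, hx'', Complex.ofReal_zero, add_zero]
  · rintro ⟨p, hp, rfl, rfl⟩
    refine ⟨fun e => (X.edge e p).fn, fun e => (X.edge e p).deriv, fun e => p.1 e,
      X.isSobolevH2 p, X.toL2_ae_eq p, fun e => ?_, fun v => ?_⟩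
    · filter_upwards [X.maxOp_ae_eq 0 p e] with x hx
      rw [hx, Complex.ofReal_zero, add_zero]
    · rw [← endValue_toMetricEdges (p := p) fun e => eqOn_refl _ _,
        ← endDeriv_toMetricEdges (p := p) fun e => eqOn_refl _ _]
      exact mem_boundary.1 hp v

theorem isEigenvalueSequence_iff (Γ : QuantumGraph V E) (l : ℕ → ℝ) :
    Γ.IsEigenvalueSequence l ↔ (Γ.toMetricEdges.hamiltonian Γ.boundary).IsEigenvalueSequence l := by
  rw [← hamiltonian_eq]
  rfl

variable [DecidableEq V]

theorem sum_endsAt {M : Type*} [AddCommMonoid M] (Γ : QuantumGraph V E) (v : V)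
    (F : E × Bool → M) : ∑ b : Γ.EndsAt v, F b = ∑ b with Γ.vert b = v, F b :=
  (Finset.sum_subtype _ (fun _ => Finset.mem_filter_univ _) F).symm

theorem sum_eq_sum_sum_endsAt {M : Type*} [AddCommMonoid M] (Γ : QuantumGraph V E)
    (F : E × Bool → M) :
    ∑ b, F b = ∑ v ∈ Finset.univ.image Γ.vert, ∑ b : Γ.EndsAt v, F b := by
  simp only [sum_endsAt]
  exact (Finset.sum_fiberwise_of_maps_to
    (fun b _ => Finset.mem_image_of_mem Γ.vert (Finset.mem_univ b)) F).symm

theorem isLagrangian_boundary (h : ∀ v, (Γ.cond v).IsLagrangian) : Γ.boundary.IsLagrangian where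
  isIsotropic x hx y hy := by
    rw [dotProduct, dotProduct, Γ.sum_eq_sum_sum_endsAt, Γ.sum_eq_sum_sum_endsAt]
    exact Finset.sum_congr rfl fun v _ =>
      (h v).isIsotropic _ (mem_boundary.1 hx v) _ (mem_boundary.1 hy v)
  exists_eq_ker := by
    choose T hT using fun v => (h v).exists_eq_ker
    let res (v : V) : (E × Bool → ℂ) × (E × Bool → ℂ) →ₗ[ℂ] (Γ.EndsAt v → ℂ) × (Γ.EndsAt v → ℂ) :=
      (LinearMap.funLeft ℂ ℂ Subtype.val).prodMap (LinearMap.funLeft ℂ ℂ Subtype.val)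
    refine ⟨LinearMap.pi fun b => (LinearMap.proj (⟨b, rfl⟩ : Γ.EndsAt (Γ.vert b))) ∘ₗ
      T (Γ.vert b) ∘ₗ res (Γ.vert b), Submodule.ext fun x => ?_⟩
    have hcond : ∀ v, res v x ∈ Γ.cond v ↔ T v (res v x) = 0 := fun v => by
      rw [hT, LinearMap.mem_ker]
    rw [mem_boundary, LinearMap.mem_ker, funext_iff]
    constructor
    · exact fun hx b => congrFun ((hcond (Γ.vert b)).1 (hx (Γ.vert b))) ⟨b, rfl⟩
    · refine fun hx v => (hcond v).2 (funext ?_)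
      rintro ⟨b, rfl⟩
      exact hx b

end QuantumGraph

end QuantumGraph

/-! ### Gluing two vertices -/

section Gluing

open scoped Matrix

namespace QuantumGraph

section GlueMap

variable {V : Type*} [DecidableEq V] {v₀ v₁ : V} (hne : v₀ ≠ v₁)

theorem glueMap_eq_glued_iff (v : V) : glueMap v₀ v₁ hne v = ⟨v₀, hne⟩ ↔ v = v₀ ∨ v = v₁ := by
  by_cases hv : v = v₁ <;> simp [glueMap, hv]

theorem eq_of_glueMap_eq {v : V} {w : {v : V // v ≠ v₁}} (hw : w.1 ≠ v₀)
    (hv : glueMap v₀ v₁ hne v = w) : v = w.1 := by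
  subst hv
  have hv₁ : v ≠ v₁ := fun h => hw (congrArg Subtype.val ((glueMap_eq_glued_iff hne v).2 (.inr h)))
  rw [glueMap, dif_neg hv₁]

end GlueMap

variable {V E : Type*} [DecidableEq V] [Fintype E] {Γ : QuantumGraph V E} {v₀ v₁ : V}

theorem isLagrangian_delta_endsAt {v : V} (hv : ∃ b, Γ.vert b = v) (α : ℝ) :
    (VertexCondition.delta (Γ.EndsAt v) α).IsLagrangian :=
  have : Nonempty (Γ.EndsAt v) := nonempty_subtype.2 hv
  VertexCondition.isLagrangian_delta α

theorem isLagrangian_boundary_of_delta {α₀ α₁ : ℝ} (hv₀ : ∃ b, Γ.vert b = v₀)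
    (hv₁ : ∃ b, Γ.vert b = v₁) (h₀ : Γ.cond v₀ = VertexCondition.delta (Γ.EndsAt v₀) α₀)
    (h₁ : Γ.cond v₁ = VertexCondition.delta (Γ.EndsAt v₁) α₁)
    (h : ∀ v, v ≠ v₀ → v ≠ v₁ → (Γ.cond v).IsLagrangian) : Γ.boundary.IsLagrangian :=
  isLagrangian_boundary fun v => by
    by_cases hvv₀ : v = v₀
    · rw [hvv₀, h₀]
      exact isLagrangian_delta_endsAt hv₀ α₀
    by_cases hvv₁ : v = v₁
    · rw [hvv₁, h₁]
      exact isLagrangian_delta_endsAt hv₁ α₁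
    exact h v hvv₀ hvv₁

variable (Γ) (hne : v₀ ≠ v₁) (α : ℝ)

theorem glue_cond_glued : (Γ.glue v₀ v₁ hne α).cond ⟨v₀, hne⟩ =
    VertexCondition.delta ((Γ.glue v₀ v₁ hne α).EndsAt ⟨v₀, hne⟩) α :=
  if_pos rfl

theorem glue_cond_of_ne {w : {v : V // v ≠ v₁}} (hw : w.1 ≠ v₀) :
    (Γ.glue v₀ v₁ hne α).cond w = VertexCondition.transport
      (κ := (Γ.glue v₀ v₁ hne α).EndsAt w) (fun b : Γ.EndsAt w.1 =>
        ⟨b.1, (congrArg (glueMap v₀ v₁ hne) b.2).trans (glueMap_coe v₀ v₁ hne w)⟩)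
      (Γ.cond w.1) :=
  if_neg hw

variable {Γ}

theorem isLagrangian_boundary_glue (hv₀ : ∃ b, Γ.vert b = v₀)
    (h : ∀ v, v ≠ v₀ → v ≠ v₁ → (Γ.cond v).IsLagrangian) :
    (Γ.glue v₀ v₁ hne α).boundary.IsLagrangian := isLagrangian_boundary fun w => by
  by_cases hw : w.1 = v₀
  · obtain rfl : w = ⟨v₀, hne⟩ := Subtype.ext hw
    rw [glue_cond_glued]
    exact isLagrangian_delta_endsAt
      (hv₀.imp fun b hb => (glueMap_eq_glued_iff hne _).2 (.inl hb)) α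
  · rw [glue_cond_of_ne Γ hne α hw]
    exact (h w.1 hw w.2).transport
      ⟨fun b c hbc => Subtype.ext (congrArg (fun z : (Γ.glue v₀ v₁ hne α).EndsAt w => z.1) hbc),
        fun b => ⟨⟨b.1, eq_of_glueMap_eq hne hw b.2⟩, rfl⟩⟩

variable (Γ) in
theorem sum_endsAt_glued {M : Type*} [AddCommMonoid M] (F : E × Bool → M) :
    ∑ b : (Γ.glue v₀ v₁ hne α).EndsAt ⟨v₀, hne⟩, F b =
      ∑ b : Γ.EndsAt v₀, F b + ∑ b : Γ.EndsAt v₁, F b := by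
  classical
  have hdisj := Finset.disjoint_filter (s := .univ) (p := (Γ.vert · = v₀)) (q := (Γ.vert · = v₁)).2
    fun b _ hb₀ hb₁ => hne (hb₀.symm.trans hb₁)
  rw [sum_endsAt, sum_endsAt, sum_endsAt, ← Finset.sum_union hdisj, ← Finset.filter_or]
  exact Finset.sum_congr (Finset.filter_congr fun b _ => glueMap_eq_glued_iff hne _)
    fun _ _ => rfl

variable {hne α} {α₀ α₁ : ℝ} {b₀ b₁ : E × Bool} {x : (E × Bool → ℂ) × (E × Bool → ℂ)}

theorem mem_boundary_iff_of_delta (hb₀ : Γ.vert b₀ = v₀) (hb₁ : Γ.vert b₁ = v₁)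
    (h₀ : Γ.cond v₀ = VertexCondition.delta (Γ.EndsAt v₀) α₀)
    (h₁ : Γ.cond v₁ = VertexCondition.delta (Γ.EndsAt v₁) α₁) : x ∈ Γ.boundary ↔
      (∀ v, v ≠ v₀ → v ≠ v₁ →
        ((fun b : Γ.EndsAt v => x.1 b), fun b : Γ.EndsAt v => x.2 b) ∈ Γ.cond v) ∧
      ((∀ b : Γ.EndsAt v₀, x.1 b = x.1 b₀) ∧ ∑ c : Γ.EndsAt v₀, x.2 c = α₀ * x.1 b₀) ∧
      (∀ b : Γ.EndsAt v₁, x.1 b = x.1 b₁) ∧ ∑ c : Γ.EndsAt v₁, x.2 c = α₁ * x.1 b₁ := by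
  have hcond₀ := VertexCondition.mem_delta_iff (⟨b₀, hb₀⟩ : Γ.EndsAt v₀) (α := α₀)
    (x := (fun b => x.1 b, fun b => x.2 b))
  have hcond₁ := VertexCondition.mem_delta_iff (⟨b₁, hb₁⟩ : Γ.EndsAt v₁) (α := α₁)
    (x := (fun b => x.1 b, fun b => x.2 b))
  rw [← h₀] at hcond₀
  rw [← h₁] at hcond₁
  rw [mem_boundary]
  refine ⟨fun h => ⟨fun v _ _ => h v, hcond₀.1 (h v₀), hcond₁.1 (h v₁)⟩,
    fun ⟨hother, hx₀, hx₁⟩ v => ?_⟩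
  by_cases hv₀ : v = v₀
  · exact hv₀ ▸ hcond₀.2 hx₀
  by_cases hv₁ : v = v₁
  · exact hv₁ ▸ hcond₁.2 hx₁
  exact hother v hv₀ hv₁

theorem mem_boundary_glue_iff (hb₀ : Γ.vert b₀ = v₀) :
    x ∈ (Γ.glue v₀ v₁ hne α).boundary ↔
      (∀ v, v ≠ v₀ → v ≠ v₁ →
        ((fun b : Γ.EndsAt v => x.1 b), fun b : Γ.EndsAt v => x.2 b) ∈ Γ.cond v) ∧
      (∀ b, Γ.vert b = v₀ ∨ Γ.vert b = v₁ → x.1 b = x.1 b₀) ∧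
      ∑ c : Γ.EndsAt v₀, x.2 c + ∑ c : Γ.EndsAt v₁, x.2 c = α * x.1 b₀ := by
  let Γ' := Γ.glue v₀ v₁ hne α
  have hends : ∀ b, Γ'.vert b = ⟨v₀, hne⟩ ↔ Γ.vert b = v₀ ∨ Γ.vert b = v₁ :=
    fun b => glueMap_eq_glued_iff hne (Γ.vert b)
  have hglued := VertexCondition.mem_delta_iff
    (⟨b₀, (hends b₀).2 (.inl hb₀)⟩ : Γ'.EndsAt ⟨v₀, hne⟩) (α := α)
    (x := (fun b => x.1 b, fun b => x.2 b))
  rw [← glue_cond_glued, Γ.sum_endsAt_glued hne α x.2, Subtype.forall] at hglued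
  simp only [hends] at hglued
  rw [mem_boundary]
  refine ⟨fun h => ⟨fun v hv₀ hv₁ => ?_, hglued.1 (h ⟨v₀, hne⟩)⟩, fun ⟨hother, hx⟩ w => ?_⟩
  · have hv := h ⟨v, hv₁⟩
    rwa [glue_cond_of_ne Γ hne α hv₀] at hv
  · by_cases hw : w.1 = v₀
    · obtain rfl : w = ⟨v₀, hne⟩ := Subtype.ext hw
      exact hglued.2 hx
    · rw [glue_cond_of_ne Γ hne α hw]
      exact hother w.1 hw w.2

theorem mem_boundary_glue_of_mem_boundary (hb₀ : Γ.vert b₀ = v₀) (hb₁ : Γ.vert b₁ = v₁)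
    (h₀ : Γ.cond v₀ = VertexCondition.delta (Γ.EndsAt v₀) α₀)
    (h₁ : Γ.cond v₁ = VertexCondition.delta (Γ.EndsAt v₁) α₁)
    (hx : x ∈ Γ.boundary) (heq : x.1 b₀ = x.1 b₁) :
    x ∈ (Γ.glue v₀ v₁ hne (α₀ + α₁)).boundary := by
  obtain ⟨hother, ⟨hcont₀, hsum₀⟩, hcont₁, hsum₁⟩ := (mem_boundary_iff_of_delta hb₀ hb₁ h₀ h₁).1 hx
  refine (mem_boundary_glue_iff hb₀).2 ⟨hother, fun b hb => ?_, ?_⟩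
  · exact hb.elim (fun hb => hcont₀ ⟨b, hb⟩) fun hb => (hcont₁ ⟨b, hb⟩).trans heq.symm
  · rw [hsum₀, hsum₁, ← heq, ← add_mul, Complex.ofReal_add]

theorem sum_endsAt_single [DecidableEq E] {M : Type*} [AddCommMonoid M] (Γ : QuantumGraph V E)
    (v : V) (b : E × Bool) (a : M) :
    ∑ c : Γ.EndsAt v, (Pi.single b a : E × Bool → M) c = if Γ.vert b = v then a else 0 := by
  rw [sum_endsAt, Finset.sum_pi_single']
  simp only [Finset.mem_filter_univ]

/-- Moving a multiple of `1` from the derivative along one edge end at `v₀` to the derivative along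
one edge end at `v₁` restores both δ-type conditions; the boundary form does not change because the
function takes the same value at the two edge ends. -/
theorem exists_mem_boundary_of_mem_boundary_glue (hb₀ : Γ.vert b₀ = v₀) (hb₁ : Γ.vert b₁ = v₁)
    (h₀ : Γ.cond v₀ = VertexCondition.delta (Γ.EndsAt v₀) α₀)
    (h₁ : Γ.cond v₁ = VertexCondition.delta (Γ.EndsAt v₁) α₁)
    (hx : x ∈ (Γ.glue v₀ v₁ hne (α₀ + α₁)).boundary) :
    ∃ F', (x.1, F') ∈ Γ.boundary ∧ F' ⬝ᵥ star x.1 = x.2 ⬝ᵥ star x.1 := by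
  classical
  obtain ⟨hother, hcont, hsum⟩ := (mem_boundary_glue_iff hb₀).1 hx
  have hval : x.1 b₁ = x.1 b₀ := hcont b₁ (.inr hb₁)
  let τ : ℂ := α₀ * x.1 b₀ - ∑ c : Γ.EndsAt v₀, x.2 c
  let d : E × Bool → ℂ := Pi.single b₀ τ - Pi.single b₁ τ
  have sum_d : ∀ v, ∑ c : Γ.EndsAt v, d c =
      (if v₀ = v then τ else 0) - if v₁ = v then τ else 0 := fun v => by
    simp only [d, Pi.sub_apply, Finset.sum_sub_distrib, sum_endsAt_single, hb₀, hb₁]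
  have d_eq_zero : ∀ v, v ≠ v₀ → v ≠ v₁ → ∀ c : Γ.EndsAt v, d c = 0 := fun v hv₀ hv₁ c => by
    have hc₀ : c.1 ≠ b₀ := fun h => hv₀ (c.2.symm.trans (h ▸ hb₀))
    have hc₁ : c.1 ≠ b₁ := fun h => hv₁ (c.2.symm.trans (h ▸ hb₁))
    simp only [d, Pi.sub_apply, Pi.single_eq_of_ne hc₀, Pi.single_eq_of_ne hc₁, sub_zero]
  refine ⟨x.2 + d, (mem_boundary_iff_of_delta hb₀ hb₁ h₀ h₁).2
    ⟨fun v hv₀ hv₁ => ?_, ⟨fun b => hcont b (.inl b.2), ?_⟩,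
      fun b => (hcont b (.inr b.2)).trans hval.symm, ?_⟩, ?_⟩
  · simp only [Pi.add_apply, d_eq_zero v hv₀ hv₁, add_zero]
    exact hother v hv₀ hv₁
  · simp only [Pi.add_apply, Finset.sum_add_distrib, sum_d, if_pos, if_neg hne.symm, τ]
    ring
  · simp only [Pi.add_apply, Finset.sum_add_distrib, sum_d, if_pos, if_neg hne, τ]
    rw [Complex.ofReal_add] at hsum
    linear_combination hsum + α₁ * hval.symm
  · rw [add_dotProduct, sub_dotProduct, single_dotProduct, single_dotProduct, Pi.star_apply,
      Pi.star_apply, hval, sub_self, add_zero]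

end QuantumGraph

end Gluing

theorem theorem5p3_general {V E : Type*} [DecidableEq V] [Fintype E]
    (Γ : QuantumGraph V E) (v₀ v₁ : V) (hne : v₀ ≠ v₁)
    (hv₀ : ∃ b, Γ.vert b = v₀) (hv₁ : ∃ b, Γ.vert b = v₁) (α₀ α₁ : ℝ)
    (h₀ : Γ.cond v₀ = VertexCondition.delta (Γ.EndsAt v₀) α₀)
    (h₁ : Γ.cond v₁ = VertexCondition.delta (Γ.EndsAt v₁) α₁)
    (hsa : ∀ v, v ≠ v₀ → v ≠ v₁ → (Γ.cond v).IsSelfAdjoint) :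
    (∃ l, Γ.IsEigenvalueSequence l) ∧
    (∃ l', (Γ.glue v₀ v₁ hne (α₀ + α₁)).IsEigenvalueSequence l') ∧
    ∀ l l' : ℕ → ℝ, Γ.IsEigenvalueSequence l →
      (Γ.glue v₀ v₁ hne (α₀ + α₁)).IsEigenvalueSequence l' →
      ∀ n, l n ≤ l' n ∧ l' n ≤ l (n + 1) := by
  have hlag : ∀ v, v ≠ v₀ → v ≠ v₁ → (Γ.cond v).IsLagrangian :=
    fun v hvv₀ hvv₁ => (hsa v hvv₀ hvv₁).isLagrangian
  have hM := QuantumGraph.isLagrangian_boundary_of_delta hv₀ hv₁ h₀ h₁ hlag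
  have hM' := QuantumGraph.isLagrangian_boundary_glue hne (α₀ + α₁) hv₀ hlag
  obtain ⟨b₀, hb₀⟩ := hv₀
  obtain ⟨b₁, hb₁⟩ := hv₁
  have : Nonempty E := ⟨b₀.1⟩
  let jump : (E × Bool → ℂ) × (E × Bool → ℂ) →ₗ[ℂ] ℂ :=
    (LinearMap.proj (R := ℂ) (φ := fun _ => ℂ) b₀ - LinearMap.proj b₁) ∘ₗ LinearMap.fst ℂ _ _
  simp only [QuantumGraph.isEigenvalueSequence_iff]
  refine ⟨MetricEdges.exists_isEigenvalueSequence _ hM,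
    MetricEdges.exists_isEigenvalueSequence _ hM', fun l l' hl hl' n => ⟨?_, ?_⟩⟩
  · exact MetricEdges.eigenvalue_mono hM hM'
      (fun x => QuantumGraph.exists_mem_boundary_of_mem_boundary_glue hb₀ hb₁ h₀ h₁) hl hl' n
  · rw [← Module.finrank_self ℂ]
    exact MetricEdges.eigenvalue_le_add_finrank hM hM' jump
      (fun x hx hjump => QuantumGraph.mem_boundary_glue_of_mem_boundary hb₀ hb₁ h₀ h₁ hx
        (sub_eq_zero.1 hjump)) hl hl' n

theorem theorem5p3 {V E : Type*} [Finite V] [DecidableEq V] [Fintype E]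
    (Γ : QuantumGraph V E) (v₀ v₁ : V) (hne : v₀ ≠ v₁)
    (hv₀ : ∃ b, Γ.vert b = v₀) (hv₁ : ∃ b, Γ.vert b = v₁) (α₀ α₁ : ℝ)
    (h₀ : Γ.cond v₀ = VertexCondition.delta (Γ.EndsAt v₀) α₀)
    (h₁ : Γ.cond v₁ = VertexCondition.delta (Γ.EndsAt v₁) α₁)
    (hsa : ∀ v, v ≠ v₀ → v ≠ v₁ → (Γ.cond v).IsSelfAdjoint) :
    (∃ l, Γ.IsEigenvalueSequence l) ∧
    (∃ l', (Γ.glue v₀ v₁ hne (α₀ + α₁)).IsEigenvalueSequence l') ∧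
    ∀ l l' : ℕ → ℝ, Γ.IsEigenvalueSequence l →
      (Γ.glue v₀ v₁ hne (α₀ + α₁)).IsEigenvalueSequence l' →
      ∀ n, l n ≤ l' n ∧ l' n ≤ l (n + 1) :=
  theorem5p3_general Γ v₀ v₁ hne hv₀ hv₁ α₀ α₁ h₀ h₁ hsa
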